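/- All graphs are finite and simple. A \emph{cograph} is a graph obtained from one-vertex graphs by taking complements and disjoint unions (up to isomorphism). A \emph{path cover} of $G$ is a spanning subgraph of $G$ all of whose components are paths (single vertices allowed); it is \emph{optimal} if it has the maximum number of edges. For a tree $T$ let $i(T)$ be the number of its vertices of degree at least $2$ (internal vertices), and let $\mathrm{Opt}(G)$ be the maximum of $i(T)$ over all spanning trees $T$ of $G$. A \emph{binary cotree} of $G$ is a rooted binary tree whose leaves are precisely the vertices of $G$ and whose internal nodes are labelled $0$ or $1$, such that two distinct vertices are adjacent in $G$ if and only if their lowest common ancestor is labelled $1$. It is preprocessed by exchanging subtrees so that at every node the left subtree has at most as many leaves as the right one. Let $L$ and $R$ be the sets of leaves of the left and the right subtree of the root. Lin, Olariu and Pruesse's algorithm computes a path cover from a preprocessed binary cotree bottom-up. For a leaf it takes the one-vertex path, and at a $0$-node it takes the union of the path covers of the two sides. At a $1$-node let $A$ be the vertex set of the left side and $Q$ the path cover of the right side, with $|Q|$ paths. If $|A|<|Q|$, all vertices of $A$ are used as bridges that join $|A|+1$ paths of $Q$ into one path, and the other paths of $Q$ are kept. If $|A|\ge|Q|$, then $|Q|-1$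 vertices of $A$ are used as bridges that join all paths of $Q$ into one, and the other vertices of $A$ are inserted between vertices that are consecutive on a path of $Q$, at most one being left over, which is put at the end of the path. The spanning tree algorithm takes a binary cotree of $G$, preprocesses it, and computes this path cover $P^*=\{P_1,\dots,P_k\}$. If $k=1$ it returns $P^*$. If $k\ge2$, let $P_1$ be the path that contains vertices of both $L$ and $R$; choose any $u\in V(P_1)\cap L$ and any end vertex $v_i$ of $P_i$ for each $2\le i\le k$, and return $P^*$ together with the edges $uv_2,\dots,uv_k$. \textbf{Theorem.} Let $G$ be a connected cograph with at least two vertices. Then $G$ has a binary cotree. For every binary cotree of $G$, the path cover computed in the algorithm is optimal, and either it is a single path, or it has at least two paths, one of which contains vertices of both $L$ and $R$ while all the others contain vertices of $R$ only. The algorithm always has an output, and for all choices of $u$ and the $v_i$ its output is a spanning tree $T$ of $G$ with $i(T)=|E(P)|-1$, where $P$ is any optimal path cover of $G$. The same is true if the algorithm starts instead from any other optimal path cover of this form. Hence $\mathrm{Opt}(G)=|E(P)|-1$ for every optimal path cover $P$ of $G$. -/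

import Mathlib

universe u

namespace CographMIST

/-- Cographs: the smallest class of graphs, closed under isomorphism, that contains the one-vertex
graphs and is closed under complements and disjoint unions. -/
inductive IsCograph : {V : Type u} → SimpleGraph V → Prop
  | single {V : Type u} [Nonempty V] [Subsingleton V] (G : SimpleGraph V) : IsCograph G
  | compl {V : Type u} {G : SimpleGraph V} : IsCograph G → IsCograph Gᶜ
  | disjUnion {V W : Type u} {G : SimpleGraph V} {H : SimpleGraph W} :
      IsCograph G → IsCograph H → IsCograph (G ⊕g H)
  | iso {V W : Type u} {G : SimpleGraph V} {H : SimpleGraph W} :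
      (G ≃g H) → IsCograph G → IsCograph H

/-! ### Spanning trees and path covers -/

section Graphs

variable {V : Type u}

/-- `T` is a spanning tree of `G`. -/
def IsSpanningTree (G T : SimpleGraph V) : Prop := T ≤ G ∧ T.IsTree

/-- The number of internal vertices, that is, of vertices of degree at least two. -/
noncomputable def internalCount (T : SimpleGraph V) : ℕ :=
  {v : V | 2 ≤ (T.neighborSet v).ncard}.ncard

/-- The largest number of internal vertices of a spanning tree of `G`
(meaningful for finite connected graphs). -/
noncomputable def opt (G : SimpleGraph V) : ℕ :=
  sSup {k : ℕ | ∃ T : SimpleGraph V, IsSpanningTree G T ∧ internalCount T = k}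

/-- The number of edges. -/
noncomputable def edgeCount (H : SimpleGraph V) : ℕ := H.edgeSet.ncard

/-- A path cover of `G`: a spanning subgraph of `G` all of whose connected components are paths
(possibly with a single vertex). -/
def IsPathCover (G P : SimpleGraph V) : Prop :=
  P ≤ G ∧ ∀ c : P.ConnectedComponent,
    ∃ n : ℕ, Nonempty (P.induce c.supp ≃g SimpleGraph.pathGraph n)

/-- A path cover with the largest number of edges. -/
def IsOptimalPathCover (G P : SimpleGraph V) : Prop :=
  IsPathCover G P ∧ ∀ Q : SimpleGraph V, IsPathCover G Q → edgeCount Q ≤ edgeCount P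

/-- `P = [P₁, …, Pₖ]` lists vertex-disjoint paths of `G`, each given by its sequence of vertices,
which together contain every vertex. -/
def IsPathSystem (G : SimpleGraph V) (P : List (List V)) : Prop :=
  (∀ p ∈ P, p ≠ [] ∧ p.IsChain G.Adj) ∧ P.flatten.Nodup ∧ ∀ v, v ∈ P.flatten

/-- The graph whose edges are the pairs of consecutive vertices of the listed paths. -/
def pathsGraph (P : List (List V)) : SimpleGraph V :=
  SimpleGraph.fromRel fun x y => ∃ p ∈ P, [x, y] <:+: p

/-- `v` is the first or the last vertex of the path `p`. -/
def IsEndVertex (v : V) (p : List V) : Prop := p.head? = some v ∨ p.getLast? = some v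

end Graphs

/-! ### Binary cotrees -/

/-- Rooted binary trees with leaves in `V` whose internal nodes are labelled `1` (`true`) or
`0` (`false`), with a left and a right subtree at each internal node. -/
inductive BinaryCotree (V : Type u) : Type u
  | leaf (v : V) : BinaryCotree V
  | node (label : Bool) (left right : BinaryCotree V) : BinaryCotree V

namespace BinaryCotree

variable {V : Type u}

/-- The leaves, from left to right. -/
def leaves : BinaryCotree V → List V
  | leaf v => [v]
  | node _ l r => l.leaves ++ r.leaves

/-- The leaves of the left subtree of the root. -/
def leftLeaves : BinaryCotree V → List V
  | leaf _ => []
  | node _ l _ => l.leaves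

/-- The leaves of the right subtree of the root. -/
def rightLeaves : BinaryCotree V → List V
  | leaf _ => []
  | node _ _ r => r.leaves

/-- In a tree with distinct leaves: the lowest common ancestor of the two different leaves
`x` and `y` is a `1`-node. -/
def LcaIsOne (x y : V) : BinaryCotree V → Prop
  | leaf _ => False
  | node b l r =>
      (x ∈ l.leaves ∧ y ∈ l.leaves ∧ l.LcaIsOne x y) ∨
      (x ∈ r.leaves ∧ y ∈ r.leaves ∧ r.LcaIsOne x y) ∨
      (((x ∈ l.leaves ∧ y ∈ r.leaves) ∨ (x ∈ r.leaves ∧ y ∈ l.leaves)) ∧ b = true)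

/-- `T` is a binary cotree of `G`: its leaves are precisely the vertices of `G`, each occurring
once, and two vertices are adjacent iff their lowest common ancestor is a `1`-node. -/
def IsCotreeOf (T : BinaryCotree V) (G : SimpleGraph V) : Prop :=
  T.leaves.Nodup ∧ (∀ v, v ∈ T.leaves) ∧ ∀ x y, x ≠ y → (G.Adj x y ↔ T.LcaIsOne x y)

/-- Preprocessing: exchange the two subtrees of internal nodes where necessary, so that at every
node the left subtree has at most as many leaves as the right one. -/
def arrange : BinaryCotree V → BinaryCotree V
  | leaf v => leaf v
  | node b l r =>
      if l.leaves.length ≤ r.leaves.length then node b l.arrange r.arrange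
      else node b r.arrange l.arrange

end BinaryCotree

/-! ### The path cover algorithm of Lin, Olariu and Pruesse

At a `0`-node the path covers of the two sides are put together. At a `1`-node let `A` be the list
of vertices of the smaller (left) side and `Q` the path cover of the larger (right) side. The
vertices in `A` serve as bridges which connect paths of `Q`; if `Q` has at most `|A|` paths, then
`|Q| - 1` of them connect all paths to a single one and the others are inserted between
consecutive vertices of the right side, at most one being left over for the end of the path. -/

section Lin

variable {V : Type u}

/-- Connect the first paths of the list by means of the given bridge vertices. -/
def bridge : List V → List (List V) → List (List V)
  | a :: A, p :: q :: Q => bridge A ((p ++ a :: q) :: Q)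
  | _, Q => Q

/-- Insert vertices into the gaps between consecutive vertices of a path; returns the new path and
the vertices that have not been used. -/
def insertInPath : List V → List V → List V × List V
  | b :: B, x :: y :: p =>
      let r := insertInPath B (y :: p)
      (x :: b :: r.1, r.2)
  | B, p => (p, B)

/-- Insert vertices into the gaps of several paths, one path after the other. -/
def insertInPaths : List V → List (List V) → List (List V) × List V
  | B, [] => ([], B)
  | B, p :: Q =>
      let r := insertInPath B p
      let s := insertInPaths r.2 Q
      (r.1 :: s.1, s.2)

/-- The step at a `1`-node. -/
def joinCover (A : List V) (Q : List (List V)) : List (List V) :=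
  if A.length < Q.length then bridge A Q
  else
    let s := insertInPaths (A.drop (Q.length - 1)) Q
    [(bridge (A.take (Q.length - 1)) s.1).flatten ++ s.2]

/-- The path cover computed from a preprocessed binary cotree. -/
def linPathCover : BinaryCotree V → List (List V)
  | .leaf v => [[v]]
  | .node false l r => linPathCover l ++ linPathCover r
  | .node true l r => joinCover l.leaves (linPathCover r)

end Lin

/-! ### The spanning tree algorithm -/

section Algorithm

variable {V : Type u}

/-- The path covers from which the spanning tree algorithm may start, for a graph `G` with
preprocessed cotree `T`: optimal path covers that consist of a single path, or of at least two
paths, one of which contains vertices from both sides of `T` while all the others contain vertices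
from the right side only. -/
def IsStartingCover (G : SimpleGraph V) (T : BinaryCotree V) (P : List (List V)) : Prop :=
  IsPathSystem G P ∧ IsOptimalPathCover G (pathsGraph P) ∧
    (P.length = 1 ∨
      (2 ≤ P.length ∧ ∃ p₁ ∈ P,
        (∃ x ∈ p₁, x ∈ T.leftLeaves) ∧ (∃ y ∈ p₁, y ∈ T.rightLeaves) ∧
        ∀ p ∈ P, p ≠ p₁ → ∀ v ∈ p, v ∈ T.rightLeaves))

/-- `S` is a possible output of the spanning tree algorithm for the path cover `P` and the
preprocessed cotree `T`. If `P` is a single path, that path is returned. Otherwise let `p₁` be the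
path which contains vertices from both sides, choose any vertex `u` of `p₁` from the left side and
any end vertex `e p` of each of the other paths `p`, add the edges between `u` and the chosen end
vertices to the edges of the path cover, and return the result. -/
def IsOutput (T : BinaryCotree V) (P : List (List V)) (S : SimpleGraph V) : Prop :=
  (P.length = 1 ∧ S = pathsGraph P) ∨
  (P.length ≠ 1 ∧ ∃ p₁ ∈ P,
    (∃ x ∈ p₁, x ∈ T.leftLeaves) ∧ (∃ y ∈ p₁, y ∈ T.rightLeaves) ∧
    ∃ u ∈ p₁, u ∈ T.leftLeaves ∧
    ∃ e : List V → V, (∀ p ∈ P, p ≠ p₁ → IsEndVertex (e p) p) ∧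
      S = pathsGraph P ⊔ SimpleGraph.fromEdgeSet {s(u, e p) | (p ∈ P) (_ : p ≠ p₁)})

/-- The whole algorithm for a cograph with binary cotree `T`: preprocess `T`, compute the path cover
of Lin, Olariu and Pruesse, attach its paths to each other. -/
def IsAlgorithmOutput (T : BinaryCotree V) (S : SimpleGraph V) : Prop :=
  IsOutput T.arrange (linPathCover T.arrange) S

end Algorithm

end CographMIST

/-! Write `n` for the number of vertices and `k` for the number of paths of an optimal cover, which
then has `n - k` edges. Three independent arguments are combined.

Upper bound, valid in every graph (`internalCount_lt_edgeCount`): in a spanning tree `T` the sum of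
`min (deg v) 2` is `n + i(T)`. Deleting an edge at a vertex of degree at least three lowers this sum
by at most one. Deleting such edges until the maximum degree is at most two leaves a linear forest
`H`, and `n + i(T) ≤ 2 e(H) + (e(T) - e(H)) = e(H) + n - 1`. So `H` is a path cover with at least
`i(T) + 1` edges.

Lower bound (`card_le_internalCount_starGraph`): joining one vertex of a path to an end of each
other path gives a spanning tree in which only the two ends of the first path and the free end of
each other path can be leaves. At most `k + 1` leaves remain, hence at least `e(P) - 1` internal
vertices. The added edges exist because connectivity makes the root a `1`-node, so that `u` in `L`
is adjacent to all of `R`.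

Optimality of the computed cover (`lowerCount_add_length_le`): by induction on the cotree, no path
cover has more than `m - k` edges inside a subtree with `m` leaves and `k` computed paths. At a
`1`-node, the vertices of `A` meet at most `2|A|` edges and a linear forest on `m` vertices has at
most `m - 1`; these two bounds match `max 1 (|Q| - |A|)`. -/

namespace CographMIST

/-! ### Path systems as lists, their edge counts, and the star construction -/

section PathSystems

variable {V : Type u} {G : SimpleGraph V} {P : List (List V)}

lemma pair_infix_iff_getElem? {x y : V} {p : List V} :
    [x, y] <:+: p ↔ ∃ i : ℕ, p[i]? = some x ∧ p[i + 1]? = some y := by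
  constructor
  · rintro ⟨s, t, rfl⟩
    exact ⟨s.length, by simp, by simp⟩
  · rintro ⟨i, hi, hj⟩
    obtain ⟨hi', rfl⟩ := List.getElem?_eq_some_iff.1 hi
    obtain ⟨hj', rfl⟩ := List.getElem?_eq_some_iff.1 hj
    refine ⟨p.take i, p.drop (i + 2), ?_⟩
    rw [List.append_assoc]
    simp only [List.cons_append, List.nil_append, List.getElem_cons_drop, List.take_append_drop]

lemma pathsGraph_adj {x y : V} :
    (pathsGraph P).Adj x y ↔
      x ≠ y ∧ ((∃ p ∈ P, [x, y] <:+: p) ∨ ∃ p ∈ P, [y, x] <:+: p) := Iff.rfl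

lemma pathsGraph_adj_of_infix (hn : P.flatten.Nodup) {p : List V} (hp : p ∈ P) {x y : V}
    (h : [x, y] <:+: p) : (pathsGraph P).Adj x y := by
  refine pathsGraph_adj.2 ⟨?_, .inl ⟨p, hp, h⟩⟩
  have := h.sublist.nodup ((List.nodup_flatten.1 hn).1 p hp)
  simpa using this

lemma eq_of_mem_of_mem (hn : P.flatten.Nodup) {p q : List V} (hp : p ∈ P) (hq : q ∈ P) {x : V}
    (hxp : x ∈ p) (hxq : x ∈ q) : p = q := by
  by_contra hne
  have : Std.Symm (α := List V) List.Disjoint := ⟨fun _ _ h => h.symm⟩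
  exact (List.nodup_flatten.1 hn).2.forall hp hq hne hxp hxq

lemma mem_of_pathsGraph_adj (hn : P.flatten.Nodup) {p : List V} (hp : p ∈ P) {x y : V}
    (hx : x ∈ p) (h : (pathsGraph P).Adj x y) : [x, y] <:+: p ∨ [y, x] <:+: p := by
  obtain ⟨-, ⟨q, hq, h⟩ | ⟨q, hq, h⟩⟩ := pathsGraph_adj.1 h
  · rw [eq_of_mem_of_mem hn hp hq hx (h.subset (by simp))]; exact .inl h
  · rw [eq_of_mem_of_mem hn hp hq hx (h.subset (by simp))]; exact .inr h

lemma pathsGraph_le (h : IsPathSystem G P) : pathsGraph P ≤ G := by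
  intro x y hxy
  obtain ⟨-, ⟨q, hq, h'⟩ | ⟨q, hq, h'⟩⟩ := pathsGraph_adj.1 hxy
  · simpa using (h.1 q hq).2.infix h'
  · simpa [G.adj_comm] using (h.1 q hq).2.infix h'

lemma reachable_of_infix (hn : P.flatten.Nodup) {p : List V} (hp : p ∈ P) :
    ∀ l : List V, l <:+: p → ∀ x ∈ l.head?, ∀ y ∈ l, (pathsGraph P).Reachable x y
  | [], _, _, _, _, hy => by simp at hy
  | [a], _, x, hx, y, hy => by
      simp at hx hy
      rw [← hx, hy]
  | a :: b :: l, hl, x, hx, y, hy => by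
      simp only [List.head?_cons, Option.mem_some_iff] at hx
      subst hx
      rcases List.mem_cons.1 hy with rfl | hy
      · rfl
      · have hb : b :: l <:+: p := (List.infix_cons List.infix_rfl).trans hl
        refine .trans (SimpleGraph.Adj.reachable
          (pathsGraph_adj_of_infix hn hp (.trans ⟨[], l, rfl⟩ hl)))
          (reachable_of_infix hn hp (b :: l) hb b (by simp) y hy)

lemma reachable_of_mem (hn : P.flatten.Nodup) {p : List V} (hp : p ∈ P) {x y : V}
    (hx : x ∈ p) (hy : y ∈ p) : (pathsGraph P).Reachable x y := by
  cases p with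
  | nil => simp at hx
  | cons a l =>
    have h := reachable_of_infix hn hp _ List.infix_rfl a (by simp)
    exact (h x hx).symm.trans (h y hy)

lemma mem_of_reachable (hn : P.flatten.Nodup) {p : List V} (hp : p ∈ P) {x y : V}
    (hx : x ∈ p) (h : (pathsGraph P).Reachable x y) : y ∈ p := by
  obtain ⟨w⟩ := h
  induction w with
  | nil => exact hx
  | cons h _ ih =>
    refine ih ?_
    rcases mem_of_pathsGraph_adj hn hp hx h with h | h <;> exact h.subset (by simp)

/-- The component of a vertex is the set of entries of its list, and the list index is the
isomorphism to the path graph. -/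
lemma isPathCover_pathsGraph (h : IsPathSystem G P) : IsPathCover G (pathsGraph P) := by
  classical
  refine ⟨pathsGraph_le h, fun c => ?_⟩
  obtain ⟨hP, hn, hall⟩ := h
  obtain ⟨v, rfl⟩ := c.exists_rep
  obtain ⟨p, hp, hvp⟩ := List.mem_flatten.1 (hall v)
  have hnp : p.Nodup := (List.nodup_flatten.1 hn).1 p hp
  have hs : ∀ x, x ∈ p ↔
      x ∈ ((pathsGraph P).connectedComponentMk v).supp := fun x => by
    rw [SimpleGraph.ConnectedComponent.mem_supp_iff, SimpleGraph.ConnectedComponent.eq]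
    exact ⟨fun hx => reachable_of_mem hn hp hx hvp, fun hx => mem_of_reachable hn hp hvp hx.symm⟩
  let e : Fin p.length ≃ ((pathsGraph P).connectedComponentMk v).supp :=
    (hnp.getEquiv p).trans (Equiv.subtypeEquivRight hs)
  have key : ∀ i j : Fin p.length, [p[i], p[j]] <:+: p ↔ i.val + 1 = j.val := fun i j => by
    rw [pair_infix_iff_getElem?]
    constructor
    · rintro ⟨k, hk, hk'⟩
      obtain ⟨h1, h2⟩ := List.getElem?_eq_some_iff.1 hk
      obtain ⟨h3, h4⟩ := List.getElem?_eq_some_iff.1 hk'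
      have h2' := (hnp.getElem_inj_iff).1 h2
      have h4' := (hnp.getElem_inj_iff).1 h4
      omega
    · intro hij
      refine ⟨i, by simp, ?_⟩
      rw [hij]; simp
  refine ⟨p.length, ⟨SimpleGraph.Iso.symm ⟨e, ?_⟩⟩⟩
  intro i j
  rw [SimpleGraph.pathGraph_adj]
  change (pathsGraph P).Adj p[i] p[j] ↔ _
  rw [← key, ← key]
  constructor
  · exact fun h => mem_of_pathsGraph_adj hn hp (List.getElem_mem _) h
  · rintro (h | h)
    · exact pathsGraph_adj_of_infix hn hp h
    · exact (pathsGraph_adj_of_infix hn hp h).symm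

/-- The pairs of consecutive vertices of the listed paths. -/
def consecutivePairs (P : List (List V)) : List (Sym2 V) :=
  P.flatMap fun p => (p.zip p.tail).map fun e => s(e.1, e.2)

lemma edgeSet_pathsGraph_subset : (pathsGraph P).edgeSet ⊆ {e | e ∈ consecutivePairs P} := by
  have key : ∀ x y : V, (∃ p ∈ P, [x, y] <:+: p) → s(x, y) ∈ consecutivePairs P := by
    rintro x y ⟨p, hp, h⟩
    refine List.mem_flatMap.2 ⟨p, hp, List.mem_map.2 ⟨(x, y), ?_, rfl⟩⟩
    obtain ⟨i, hi, hj⟩ := pair_infix_iff_getElem?.1 h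
    refine List.mem_iff_getElem?.2 ⟨i, ?_⟩
    rw [List.getElem?_zip_eq_some]
    exact ⟨hi, by simpa using hj⟩
  intro e
  induction e with
  | h x y =>
    intro h
    obtain ⟨-, h | h⟩ := pathsGraph_adj.1 h
    · exact key x y h
    · rw [Sym2.eq_swap]; exact key y x h

lemma length_consecutivePairs (hP : ∀ p ∈ P, p ≠ []) :
    (consecutivePairs P).length + P.length = P.flatten.length := by
  induction P with
  | nil => simp [consecutivePairs]
  | cons p P ih =>
    have h1 := ih fun q hq => hP q (List.mem_cons_of_mem _ hq)
    have h2 := List.length_pos_iff.2 (hP p (by simp))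
    have h3 : (consecutivePairs (p :: P)).length =
        (p.length - 1) + (consecutivePairs P).length := by
      simp [consecutivePairs]
    simp only [List.length_cons, List.flatten_cons, List.length_append]
    omega

lemma length_eq_card [Finite V] {l : List V} (hn : l.Nodup) (h : ∀ v, v ∈ l) :
    l.length = Nat.card V := by
  classical
  rw [Nat.card_congr (hn.getEquivOfForallMemList l h).symm, Nat.card_fin]

lemma ncard_le_length {α : Type*} (l : List α) : {a | a ∈ l}.ncard ≤ l.length := by
  classical
  rw [← List.coe_toFinset, Set.ncard_coe_finset]
  exact List.toFinset_card_le l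

/-- The edges which join `u` to a vertex of each path other than `p₁`. -/
lemma ncard_star_le {u : V} {p₁ : List V} (hp₁ : p₁ ∈ P) (e : List V → V) :
    {s(u, e p) | (p ∈ P) (_ : p ≠ p₁)}.ncard + 1 ≤ P.length := by
  classical
  have h : {s(u, e p) | (p ∈ P) (_ : p ≠ p₁)} ⊆
      {a | a ∈ (P.erase p₁).map fun p => s(u, e p)} := by
    rintro _ ⟨p, hp, hne, rfl⟩
    exact List.mem_map.2 ⟨p, (List.mem_erase_of_ne hne).2 hp, rfl⟩
  have h1 := Set.ncard_le_ncard h (List.finite_toSet _)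
  have h2 := h1.trans (ncard_le_length _)
  rw [List.length_map, List.length_erase_of_mem hp₁] at h2
  have := List.length_pos_of_mem hp₁
  omega

/-- The union of the listed paths and of a star that joins a vertex of one of them to all others. -/
abbrev starGraph (P : List (List V)) (p₁ : List V) (u : V) (e : List V → V) : SimpleGraph V :=
  pathsGraph P ⊔ SimpleGraph.fromEdgeSet {s(u, e p) | (p ∈ P) (_ : p ≠ p₁)}

/-- Besides giving spanning trees, this yields lower bounds on edge counts, since a connected graph
has at least `n - 1` edges. -/
lemma starGraph_connected (hn : P.flatten.Nodup) (hall : ∀ v, v ∈ P.flatten) {u : V}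
    {p₁ : List V} (hp₁ : p₁ ∈ P) (hu : u ∈ p₁) {e : List V → V}
    (he : ∀ p ∈ P, p ≠ p₁ → e p ∈ p) : (starGraph P p₁ u e).Connected := by
  have key : ∀ v, (starGraph P p₁ u e).Reachable u v := by
    intro v
    obtain ⟨p, hp, hv⟩ := List.mem_flatten.1 (hall v)
    by_cases hpe : p = p₁
    · subst hpe
      exact (reachable_of_mem hn hp hu hv).mono le_sup_left
    · refine .trans ?_ ((reachable_of_mem hn hp (he p hp hpe) hv).mono le_sup_left)
      by_cases hue : u = e p
      · rw [← hue]
      · refine SimpleGraph.Adj.reachable (.inr ?_)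
        rw [SimpleGraph.fromEdgeSet_adj]
        exact ⟨⟨p, hp, hpe, rfl⟩, hue⟩
  have : Nonempty V := ⟨u⟩
  exact ⟨fun x y => (key x).symm.trans (key y)⟩

lemma edgeCount_starGraph_le [Finite V] {u : V} {p₁ : List V} (hp₁ : p₁ ∈ P) (e : List V → V) :
    edgeCount (starGraph P p₁ u e) + 1 ≤ edgeCount (pathsGraph P) + P.length := by
  have h : (starGraph P p₁ u e).edgeSet ⊆
      (pathsGraph P).edgeSet ∪ {s(u, e p) | (p ∈ P) (_ : p ≠ p₁)} := by
    rw [SimpleGraph.edgeSet_sup, SimpleGraph.edgeSet_fromEdgeSet]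
    exact Set.union_subset_union_right _ Set.sdiff_subset
  have h1 := (Set.ncard_le_ncard h (Set.toFinite _)).trans (Set.ncard_union_le _ _)
  have h2 := ncard_star_le (u := u) hp₁ e
  unfold edgeCount
  omega

/-- A path system with `k` paths on `n` vertices has `n - k` edges. -/
lemma edgeCount_pathsGraph_add_length [Finite V] [Nonempty V] (h : IsPathSystem G P) :
    edgeCount (pathsGraph P) + P.length = Nat.card V := by
  obtain ⟨hP, hn, hall⟩ := h
  have h0 := length_eq_card hn hall
  apply le_antisymm
  · have h1 := (Set.ncard_le_ncard edgeSet_pathsGraph_subset (List.finite_toSet _)).trans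
      (ncard_le_length (consecutivePairs P))
    have h2 := length_consecutivePairs fun p hp => (hP p hp).1
    unfold edgeCount
    omega
  -- For the lower bound no injectivity of the pair list is needed: adding at most `k - 1` star
  -- edges makes the graph connected, so at least `n - k` edges were there before.
  · obtain ⟨u⟩ := ‹Nonempty V›
    obtain ⟨p₁, hp₁, hu⟩ := List.mem_flatten.1 (hall u)
    have hc := starGraph_connected hn hall hp₁ hu (e := fun p => p.headD u) (by
      intro p hp _
      cases p with
      | nil => exact absurd rfl (hP _ hp).1
      | cons a l => simp)
    have h1 := hc.card_vert_le_card_edgeSet_add_one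
    rw [Nat.card_coe_set_eq] at h1
    exact h1.trans (edgeCount_starGraph_le hp₁ _)

/-- The star that joins an end of each path to one vertex yields a spanning tree. -/
lemma isSpanningTree_starGraph [Finite V] [Nonempty V] (h : IsPathSystem G P) {u : V}
    {p₁ : List V} (hp₁ : p₁ ∈ P) (hu : u ∈ p₁) {e : List V → V}
    (he : ∀ p ∈ P, p ≠ p₁ → e p ∈ p) (hadj : ∀ p ∈ P, p ≠ p₁ → G.Adj u (e p)) :
    IsSpanningTree G (starGraph P p₁ u e) := by
  have hc := starGraph_connected h.2.1 h.2.2 hp₁ hu he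
  refine ⟨sup_le (pathsGraph_le h) ?_, ?_⟩
  · intro x y hxy
    rw [SimpleGraph.fromEdgeSet_adj] at hxy
    obtain ⟨⟨p, hp, hne, hs⟩, -⟩ := hxy
    have := hadj p hp hne
    rwa [← SimpleGraph.mem_edgeSet, hs, SimpleGraph.mem_edgeSet] at this
  · rw [SimpleGraph.isTree_iff_connected_and_card]
    refine ⟨hc, ?_⟩
    have h1 := hc.card_vert_le_card_edgeSet_add_one
    have h2 := edgeCount_starGraph_le (u := u) hp₁ e
    have h3 := edgeCount_pathsGraph_add_length h
    unfold edgeCount at *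
    rw [Nat.card_coe_set_eq] at *
    omega

end PathSystems
-- Upper bound: pruning a tree to a path cover
section TreeBound

variable {V : Type u} {G : SimpleGraph V} {P : List (List V)}

lemma IsEndVertex.mem {v : V} {p : List V} (h : IsEndVertex v p) : v ∈ p :=
  h.elim List.mem_of_head? List.mem_of_getLast?

lemma exists_adj_adj_of_not_isEndVertex (hn : P.flatten.Nodup) {p : List V} (hp : p ∈ P) {x : V}
    (hx : x ∈ p) (hend : ¬ IsEndVertex x p) :
    ∃ a b, a ≠ b ∧ (pathsGraph P).Adj x a ∧ (pathsGraph P).Adj x b := by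
  obtain ⟨i, hi, rfl⟩ := List.getElem_of_mem hx
  have hnp : p.Nodup := (List.nodup_flatten.1 hn).1 p hp
  have h0 : i ≠ 0 := by
    rintro rfl
    exact hend (.inl (by rw [List.head?_eq_getElem?]; simp))
  have h1 : i + 1 ≠ p.length := by
    intro h
    refine hend (.inr ?_)
    rw [List.getLast?_eq_getElem?, ← h]
    simp
  refine ⟨p[i - 1], p[i + 1], ?_, ?_, ?_⟩
  · rw [Ne, hnp.getElem_inj_iff]; omega
  · refine (pathsGraph_adj_of_infix hn hp (pair_infix_iff_getElem?.2 ⟨i - 1, by simp, ?_⟩)).symm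
    rw [Nat.sub_add_cancel (by omega)]; simp
  · exact pathsGraph_adj_of_infix hn hp (pair_infix_iff_getElem?.2 ⟨i, by simp, by simp⟩)

lemma exists_perm_getLast?_eq {p : List V} (hc : p.IsChain G.Adj) {v : V}
    (h : IsEndVertex v p) : ∃ q : List V, q.Perm p ∧ q.IsChain G.Adj ∧ q.getLast? = some v := by
  rcases h with h | h
  · refine ⟨p.reverse, p.reverse_perm, ?_, by simpa using h⟩
    rw [List.isChain_reverse]
    exact hc.imp fun _ _ h => h.symm
  · exact ⟨p, .rfl, hc, h⟩

lemma exists_perm_head?_eq {p : List V} (hc : p.IsChain G.Adj) {v : V}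
    (h : IsEndVertex v p) : ∃ q : List V, q.Perm p ∧ q.IsChain G.Adj ∧ q.head? = some v := by
  obtain ⟨q, h1, h2, h3⟩ := exists_perm_getLast?_eq hc h
  refine ⟨q.reverse, q.reverse_perm.trans h1, ?_, by simpa using h3⟩
  rw [List.isChain_reverse]
  exact h2.imp fun _ _ h => h.symm

/-- After reversing where necessary, `x` comes last in the first path and `y` first in the second,
and the two lists can be concatenated. -/
lemma exists_isPathSystem_of_adj_ends (h : IsPathSystem G P) {p q : List V} (hp : p ∈ P)
    (hq : q ∈ P) (hpq : p ≠ q) {x y : V} (hx : IsEndVertex x p) (hy : IsEndVertex y q)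
    (hxy : G.Adj x y) : ∃ P', IsPathSystem G P' ∧ P'.length + 1 = P.length := by
  classical
  obtain ⟨hP, hn, hall⟩ := h
  obtain ⟨p', hp1, hp2, hp3⟩ := exists_perm_getLast?_eq (hP p hp).2 hx
  obtain ⟨q', hq1, hq2, hq3⟩ := exists_perm_head?_eq (hP q hq).2 hy
  have hq' : q ∈ P.erase p := (List.mem_erase_of_ne hpq.symm).2 hq
  set P₀ := (P.erase p).erase q with hP₀
  have hperm : P.Perm (p :: q :: P₀) :=
    (List.perm_cons_erase hp).trans ((List.perm_cons_erase hq').cons p)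
  have hflat : ((p' ++ q') :: P₀).flatten.Perm P.flatten := by
    refine .trans ?_ hperm.flatten.symm
    simp only [List.flatten_cons, List.append_assoc]
    exact hp1.append (hq1.append_right _)
  refine ⟨(p' ++ q') :: P₀, ⟨?_, hflat.nodup_iff.2 hn, fun v => hflat.mem_iff.2 (hall v)⟩, ?_⟩
  · intro r hr
    rcases List.mem_cons.1 hr with rfl | hr
    · refine ⟨?_, List.isChain_append.2 ⟨hp2, hq2, ?_⟩⟩
      · rintro h
        simp only [List.append_eq_nil_iff] at h
        simp [h.1] at hp3
      · intro a ha b hb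
        rw [hp3] at ha
        rw [hq3] at hb
        cases ha
        cases hb
        exact hxy
    · exact hP r (List.mem_of_mem_erase (List.mem_of_mem_erase hr))
  · rw [hperm.length_eq]; simp

lemma exists_isPathSystem [Finite V] (G : SimpleGraph V) : ∃ P, IsPathSystem G P := by
  cases nonempty_fintype V
  refine ⟨Finset.univ.toList.map fun v => [v], ?_, ?_, ?_⟩
  · intro p hp
    obtain ⟨v, -, rfl⟩ := List.mem_map.1 hp
    simp
  · rw [← List.flatMap_def, List.flatMap_singleton']
    exact Finset.nodup_toList _
  · intro v
    rw [← List.flatMap_def, List.flatMap_singleton']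
    simp

/-- A forest of maximum degree at most two is the graph of a path system. -/
lemma IsAcyclic.exists_isPathSystem [Finite V] {H : SimpleGraph V} (hH : H.IsAcyclic)
    (hdeg : ∀ v, (H.neighborSet v).ncard ≤ 2) :
    ∃ P, IsPathSystem H P ∧ pathsGraph P = H := by
  classical
  -- A path system of `H` with the fewest paths uses every edge of `H`.
  have hex : ∃ k P, IsPathSystem H P ∧ P.length = k := by
    obtain ⟨P, hP⟩ := CographMIST.exists_isPathSystem H
    exact ⟨_, P, hP, rfl⟩
  obtain ⟨P, hP, hk⟩ := Nat.find_spec hex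
  have hmin : ∀ P', IsPathSystem H P' → P.length ≤ P'.length := fun P' h' => by
    rw [hk]
    exact Nat.find_min' hex ⟨P', h', rfl⟩
  refine ⟨P, hP, le_antisymm (pathsGraph_le hP) fun x y hxy => ?_⟩
  by_contra hnot
  -- An unused edge at an inner vertex of a path would be a third edge there.
  have hend : ∀ {x y : V} {p : List V}, p ∈ P → x ∈ p → H.Adj x y → ¬ (pathsGraph P).Adj x y →
      IsEndVertex x p := by
    intro x y p hp hx hxy hnot
    by_contra hend
    obtain ⟨a, b, hab, ha, hb⟩ := exists_adj_adj_of_not_isEndVertex hP.2.1 hp hx hend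
    have hsub : {a, b, y} ⊆ H.neighborSet x := by
      rintro z (rfl | rfl | rfl)
      · exact pathsGraph_le hP ha
      · exact pathsGraph_le hP hb
      · exact hxy
    have h3 : ({a, b, y} : Set V).ncard = 3 := by
      refine Set.ncard_eq_three.2 ⟨a, b, y, hab, ?_, ?_, rfl⟩
      · rintro rfl; exact hnot ha
      · rintro rfl; exact hnot hb
    have := Set.ncard_le_ncard hsub (Set.toFinite _)
    have := hdeg x
    omega
  obtain ⟨p, hp, hx⟩ := List.mem_flatten.1 (hP.2.2 x)
  obtain ⟨q, hq, hy⟩ := List.mem_flatten.1 (hP.2.2 y)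
  by_cases hpq : p = q
  · subst hpq
    -- Within one path the unused edge would close a cycle, so it would not be a bridge; between two
    -- paths it would merge them, against minimality.
    have hbr := SimpleGraph.isAcyclic_iff_forall_adj_isBridge.1 hH hxy
    rw [SimpleGraph.isBridge_iff] at hbr
    refine hbr ((reachable_of_mem hP.2.1 hp hx hy).mono ?_)
    intro a b hab
    refine ⟨pathsGraph_le hP hab, ?_⟩
    rintro ⟨h, -⟩
    apply hnot
    rw [← SimpleGraph.mem_edgeSet, ← h]
    exact hab
  · obtain ⟨P', hP', hl⟩ := exists_isPathSystem_of_adj_ends hP hp hq hpq (hend hp hx hxy hnot)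
      (hend hq hy hxy.symm fun h => hnot h.symm) hxy
    have := hmin P' hP'
    omega

lemma sum_ncard_neighborSet [Fintype V] (F : SimpleGraph V) :
    ∑ v, (F.neighborSet v).ncard = 2 * edgeCount F := by
  classical
  rw [edgeCount, ← SimpleGraph.coe_edgeFinset, Set.ncard_coe_finset,
    ← F.sum_degrees_eq_twice_card_edges]
  refine Finset.sum_congr rfl fun v _ => ?_
  rw [Set.ncard_eq_toFinset_card']
  rfl

/-- Deleting edges at vertices of degree at least three leaves a subgraph of maximum degree at
most two with many edges. -/
lemma exists_le_degree_le_two [Fintype V] (m : ℕ) (F : SimpleGraph V) (hm : edgeCount F = m) :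
    ∃ H ≤ F, (∀ v, (H.neighborSet v).ncard ≤ 2) ∧
      ∑ v, min (F.neighborSet v).ncard 2 ≤ edgeCount H + edgeCount F := by
  classical
  induction m generalizing F with
  | zero =>
    refine ⟨F, le_rfl, fun v => ?_, ?_⟩
    · have h := sum_ncard_neighborSet F
      have := Finset.single_le_sum (f := fun v => (F.neighborSet v).ncard)
        (fun _ _ => Nat.zero_le _) (Finset.mem_univ v)
      omega
    · have h := sum_ncard_neighborSet F
      have : ∑ v, min (F.neighborSet v).ncard 2 ≤ ∑ v, (F.neighborSet v).ncard :=
        Finset.sum_le_sum fun v _ => min_le_left _ _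
      omega
  | succ m ih =>
    by_cases hdeg : ∀ v, (F.neighborSet v).ncard ≤ 2
    · refine ⟨F, le_rfl, hdeg, ?_⟩
      have h := sum_ncard_neighborSet F
      have : ∑ v, min (F.neighborSet v).ncard 2 ≤ ∑ v, (F.neighborSet v).ncard :=
        Finset.sum_le_sum fun v _ => min_le_left _ _
      omega
    · push Not at hdeg
      obtain ⟨w, hw⟩ := hdeg
      obtain ⟨x, hx⟩ : (F.neighborSet w).Nonempty := by
        rw [← Set.ncard_pos]; omega
      have hwx : F.Adj w x := hx
      set F' := F.deleteEdges {s(w, x)} with hF'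
      have hle : F' ≤ F := SimpleGraph.deleteEdges_le _
      have hcount : edgeCount F' + 1 = edgeCount F := by
        rw [edgeCount, edgeCount, hF', SimpleGraph.edgeSet_deleteEdges]
        exact Set.ncard_sdiff_singleton_add_one hwx (Set.toFinite _)
      obtain ⟨H, hH, hd, hs⟩ := ih F' (by omega)
      refine ⟨H, hH.trans hle, hd, ?_⟩
      -- Only `x` can lose in the truncated degree: `w` has degree at least three and keeps at least
      -- two neighbours.
      have hv : ∀ v, min (F.neighborSet v).ncard 2 ≤
          min (F'.neighborSet v).ncard 2 + if v = x then 1 else 0 := by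
        intro v
        have hsub : ∀ z : V, (∀ y, F.Adj v y → y ≠ z → F'.Adj v y) →
            (F.neighborSet v).ncard ≤ (F'.neighborSet v).ncard + 1 := fun z hz => by
          have : F.neighborSet v ⊆ insert z (F'.neighborSet v) := by
            intro y hy
            by_cases hyz : y = z
            · exact .inl hyz
            · exact .inr (hz y hy hyz)
          exact (Set.ncard_le_ncard this (Set.toFinite _)).trans (Set.ncard_insert_le _ _)
        have hadj : ∀ a b, F'.Adj a b ↔ F.Adj a b ∧ s(a, b) ≠ s(w, x) := by
          intro a b
          rw [hF', SimpleGraph.deleteEdges_adj]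
          rfl
        by_cases hvx : v = x
        · subst hvx
          have := hsub w fun y hy hyw => (hadj _ _).2 ⟨hy, by
            rw [Ne, Sym2.eq_iff]
            rintro (⟨h, -⟩ | ⟨-, h⟩)
            · exact hwx.ne h.symm
            · exact hyw h⟩
          rw [if_pos rfl]
          omega
        · rw [if_neg hvx]
          by_cases hvw : v = w
          · subst hvw
            have := hsub x fun y hy hyw => (hadj _ _).2 ⟨hy, by
              rw [Ne, Sym2.eq_iff]
              rintro (⟨-, h⟩ | ⟨h, -⟩)
              · exact hyw h
              · exact hvx h⟩
            omega
          · have : F.neighborSet v ⊆ F'.neighborSet v := fun y hy => (hadj _ _).2 ⟨hy, by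
              rw [Ne, Sym2.eq_iff]
              rintro (⟨h, -⟩ | ⟨h, -⟩)
              · exact hvw h
              · exact hvx h⟩
            have := Set.ncard_le_ncard this (Set.toFinite _)
            omega
      have := Finset.sum_le_sum fun v (_ : v ∈ Finset.univ) => hv v
      rw [Finset.sum_add_distrib, Finset.sum_ite_eq' Finset.univ x] at this
      simp only [Finset.mem_univ, if_true] at this
      omega

/-- A tree with at least two vertices has a path cover with more edges than the tree has internal
vertices. -/
lemma IsTree.exists_isPathSystem [Finite V] [Nontrivial V] {T : SimpleGraph V} (hT : T.IsTree) :
    ∃ P, IsPathSystem T P ∧ internalCount T + 1 ≤ edgeCount (pathsGraph P) := by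
  classical
  cases nonempty_fintype V
  obtain ⟨H, hHT, hd, hs⟩ := exists_le_degree_le_two _ T rfl
  obtain ⟨P, hP, hPH⟩ := IsAcyclic.exists_isPathSystem (hT.isAcyclic.anti hHT) hd
  refine ⟨P, ⟨fun p hp => ⟨(hP.1 p hp).1, (hP.1 p hp).2.imp fun _ _ h => hHT h⟩, hP.2⟩, ?_⟩
  rw [hPH]
  -- Every degree is at least one, because `T` is connected and has more than one vertex.
  have h1 : ∀ v, min (T.neighborSet v).ncard 2 =
      1 + if 2 ≤ (T.neighborSet v).ncard then 1 else 0 := by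
    intro v
    obtain ⟨w, hw⟩ := hT.connected.preconnected.exists_adj_of_nontrivial v
    have : 0 < (T.neighborSet v).ncard := (Set.ncard_pos (Set.toFinite _)).2 ⟨w, hw⟩
    split_ifs <;> omega
  have h2 : internalCount T = ∑ v, if 2 ≤ (T.neighborSet v).ncard then 1 else 0 := by
    rw [Finset.sum_boole, internalCount, Set.ncard_eq_toFinset_card', Set.toFinset_ofPred]
    rfl
  simp only [h1, Finset.sum_add_distrib] at hs
  rw [← h2] at hs
  have h3 := (SimpleGraph.isTree_iff_connected_and_card.1 hT).2
  rw [Nat.card_coe_set_eq, Nat.card_eq_fintype_card] at h3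
  simp only [Finset.sum_const, Finset.card_univ, smul_eq_mul, mul_one] at hs
  have h4 : edgeCount T = T.edgeSet.ncard := rfl
  omega

lemma internalCount_lt_edgeCount [Finite V] [Nontrivial V] {T P : SimpleGraph V}
    (hT : IsSpanningTree G T) (hP : IsOptimalPathCover G P) :
    internalCount T + 1 ≤ edgeCount P := by
  obtain ⟨Q, hQ, hle⟩ := IsTree.exists_isPathSystem hT.2
  refine hle.trans (hP.2 _ (isPathCover_pathsGraph ⟨fun p hp => ?_, hQ.2⟩))
  exact ⟨(hQ.1 p hp).1, (hQ.1 p hp).2.imp fun _ _ h => hT.1 h⟩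

end TreeBound
-- Lower bound: internal vertices of the star construction
section Output

variable {V : Type u} {G : SimpleGraph V} {P : List (List V)}

lemma two_le_ncard_neighborSet [Finite V] {H : SimpleGraph V} {x a b : V} (hab : a ≠ b)
    (ha : H.Adj x a) (hb : H.Adj x b) : 2 ≤ (H.neighborSet x).ncard := by
  rw [← Set.ncard_pair hab]
  refine Set.ncard_le_ncard ?_ (Set.toFinite _)
  rintro z (rfl | rfl)
  · exact ha
  · exact hb

/-- Inner vertices of the paths are internal already, and attaching `e p` to `u` makes `e p`
internal unless its path is a single vertex. So each path other than `p₁` contributes at most one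
leaf, and `p₁` at most two. -/
lemma card_le_internalCount_starGraph [Finite V] (h : IsPathSystem G P) {u : V}
    {p₁ : List V} (hp₁ : p₁ ∈ P) (hu : u ∈ p₁) {e : List V → V}
    (he : ∀ p ∈ P, p ≠ p₁ → IsEndVertex (e p) p) :
    Nat.card V ≤ internalCount (starGraph P p₁ u e) + P.length + 1 := by
  classical
  obtain ⟨hP, hn, hall⟩ := h
  set S := starGraph P p₁ u e with hS
  -- The end of `p` opposite to `e p`, or `e p` itself if `p` has one vertex. The default `u` never
  -- matters, since the paths are nonempty.
  let g : List V → V := fun p =>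
    if p.head? = some (e p) then p.getLast?.getD u else p.head?.getD u
  have hsub : {v : V | 2 ≤ (S.neighborSet v).ncard}ᶜ ⊆
      {v | v ∈ [p₁.head?.getD u, p₁.getLast?.getD u] ++ (P.erase p₁).map g} := by
    intro v hv
    obtain ⟨p, hp, hvp⟩ := List.mem_flatten.1 (hall v)
    have hend : IsEndVertex v p := by
      by_contra hend
      obtain ⟨a, b, hab, ha, hb⟩ := exists_adj_adj_of_not_isEndVertex hn hp hvp hend
      exact hv (two_le_ncard_neighborSet hab (.inl ha) (.inl hb))
    by_cases hpp : p = p₁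
    · subst hpp
      rcases hend with hend | hend <;> simp [hend]
    · have hend' := he p hp hpp
      suffices hvg : v = g p by
        refine List.mem_append_right _ (List.mem_map.2 ⟨p, ?_, hvg.symm⟩)
        exact (List.mem_erase_of_ne hpp).2 hp
      by_contra hvg
      obtain ⟨hve, hgp⟩ : v = e p ∧ g p ∈ p := by
        simp only [g] at hvg ⊢
        obtain ⟨a, l, rfl⟩ := List.exists_cons_of_ne_nil (hP p hp).1
        split_ifs at hvg ⊢ with h1
        · rw [List.getLast?_eq_some_getLast (List.cons_ne_nil a l)] at hvg ⊢
          refine ⟨?_, List.getLast_mem _⟩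
          rcases hend with h2 | h2
          · rw [h2] at h1; exact Option.some.inj h1
          · rw [List.getLast?_eq_some_getLast (List.cons_ne_nil a l)] at h2
            exact absurd (Option.some.inj h2).symm hvg
        · refine ⟨?_, by simp⟩
          rcases hend with h2 | h2
          · rw [h2] at hvg; exact absurd rfl hvg
          · rcases hend' with h3 | h3
            · exact absurd h3 h1
            · rw [h2] at h3; exact Option.some.inj h3
      -- Now `v = e p` differs from the other end, so it has a neighbour on `p`; with `u`, which
      -- lies off `p`, this makes two.
      obtain ⟨w⟩ := reachable_of_mem hn hp hvp hgp
      cases w with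
      | nil => exact hvg rfl
      | @cons _ a _ hva _ =>
        have hap : a ∈ p := mem_of_reachable hn hp hvp hva.reachable
        have hau : a ≠ u := by
          rintro rfl
          exact hpp (eq_of_mem_of_mem hn hp hp₁ hap hu)
        have hvu : u ≠ e p := by
          rintro h
          exact hpp (eq_of_mem_of_mem hn hp hp₁ hvp (hve ▸ h ▸ hu))
        refine hv (two_le_ncard_neighborSet hau (.inl hva) (.inr (SimpleGraph.Adj.symm ?_)))
        rw [hve, SimpleGraph.fromEdgeSet_adj]
        exact ⟨⟨p, hp, hpp, rfl⟩, hvu⟩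
  have h1 := (Set.ncard_le_ncard hsub (List.finite_toSet _)).trans (ncard_le_length _)
  have h2 := Set.ncard_add_ncard_compl {v : V | 2 ≤ (S.neighborSet v).ncard}
  have h3 := List.length_pos_of_mem hp₁
  rw [List.length_append, List.length_map, List.length_erase_of_mem hp₁] at h1
  simp only [List.length_cons, List.length_nil] at h1
  unfold internalCount
  omega

/-- Starting from an optimal path system, the star construction yields a spanning tree with one
internal vertex less than the path system has edges. -/
lemma starGraph_spec [Finite V] [Nontrivial V] (h : IsPathSystem G P)
    (hopt : IsOptimalPathCover G (pathsGraph P)) {u : V}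
    {p₁ : List V} (hp₁ : p₁ ∈ P) (hu : u ∈ p₁) {e : List V → V}
    (he : ∀ p ∈ P, p ≠ p₁ → IsEndVertex (e p) p) (hadj : ∀ p ∈ P, p ≠ p₁ → G.Adj u (e p)) :
    IsSpanningTree G (starGraph P p₁ u e) ∧ ∀ Q, IsOptimalPathCover G Q →
      internalCount (starGraph P p₁ u e) + 1 = edgeCount Q := by
  have hT := isSpanningTree_starGraph h hp₁ hu (fun p hp hne => (he p hp hne).mem) hadj
  refine ⟨hT, fun Q hQ => ?_⟩
  have h1 := internalCount_lt_edgeCount hT hQ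
  have h2 := card_le_internalCount_starGraph h hp₁ hu he
  have h3 := edgeCount_pathsGraph_add_length h
  have h4 := hopt.2 Q hQ.1
  omega

lemma opt_add_one_eq [Finite V] [Nontrivial V] {S Q : SimpleGraph V} (hS : IsSpanningTree G S)
    (hQ : IsOptimalPathCover G Q) (h : internalCount S + 1 = edgeCount Q) :
    opt G + 1 = edgeCount Q := by
  have hle : ∀ k ∈ {k : ℕ | ∃ T : SimpleGraph V, IsSpanningTree G T ∧ internalCount T = k},
      k ≤ internalCount S := by
    rintro k ⟨T, hT, rfl⟩
    have := internalCount_lt_edgeCount hT hQ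
    omega
  have hmem : internalCount S ∈
      {k : ℕ | ∃ T : SimpleGraph V, IsSpanningTree G T ∧ internalCount T = k} := ⟨S, hS, rfl⟩
  rw [← h, opt, IsGreatest.csSup_eq ⟨hmem, hle⟩]

end Output

/-! ### Counting edges of an arbitrary path cover by numbering its vertices -/

section Positions

variable {V : Type u} {G H : SimpleGraph V}

/-- `pos` numbers the vertices of `H` so that each vertex has at most one neighbour with the
preceding and at most one neighbour with the following number, and no other neighbours. -/
def IsPosition (H : SimpleGraph V) (pos : V → ℕ) : Prop :=
  (∀ x y, H.Adj x y → pos x = pos y + 1 ∨ pos y = pos x + 1) ∧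
    ∀ x y z, H.Adj x y → H.Adj x z → pos y = pos z → y = z

/-- Number each component along its path. Different components reuse the same numbers, so `pos` is
injective only on the neighbours of a vertex. -/
lemma IsPathCover.exists_isPosition (h : IsPathCover G H) : ∃ pos, IsPosition H pos := by
  choose n f using h.2
  replace f := fun c => (f c).some
  let pos : V → ℕ := fun v => (f (H.connectedComponentMk v) ⟨v, rfl⟩).val
  have hpos : ∀ c, ∀ x (hx : x ∈ c.supp), pos x = (f c ⟨x, hx⟩).val := by
    rintro _ x rfl
    rfl
  have hmem : ∀ x y, H.Adj x y → y ∈ (H.connectedComponentMk x).supp := fun x y hxy => by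
    rw [SimpleGraph.ConnectedComponent.mem_supp_iff, SimpleGraph.ConnectedComponent.eq]
    exact hxy.symm.reachable
  refine ⟨pos, fun x y hxy => ?_, fun x y z hxy hxz hyz => ?_⟩
  · have hx : x ∈ (H.connectedComponentMk x).supp := rfl
    have h1 : (SimpleGraph.pathGraph _).Adj (f _ ⟨x, hx⟩) (f _ ⟨y, hmem x y hxy⟩) :=
      (f (H.connectedComponentMk x)).map_adj_iff.2 hxy
    rw [SimpleGraph.pathGraph_adj, ← hpos, ← hpos] at h1
    omega
  · rw [hpos _ y (hmem x y hxy), hpos _ z (hmem x z hxz)] at hyz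
    have := (f _).injective (Fin.ext hyz)
    exact congrArg Subtype.val this

open Classical in
/-- The number of vertices of `S` which have a neighbour in `S` with the preceding number. -/
noncomputable def lowerCount (H : SimpleGraph V) (pos : V → ℕ) (S : Finset V) : ℕ :=
  (S.filter fun x => ∃ y ∈ S, H.Adj x y ∧ pos x = pos y + 1).card

variable {pos : V → ℕ}

/-- Each edge is charged to its end with the larger number, which determines the edge. -/
lemma edgeCount_le_lowerCount [Fintype V] (h : IsPosition H pos) :
    edgeCount H ≤ lowerCount H pos Finset.univ := by
  classical
  have hex : ∀ x, ∃ y, (∃ y, H.Adj x y ∧ pos x = pos y + 1) → H.Adj x y ∧ pos x = pos y + 1 := by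
    intro x
    by_cases hx : ∃ y, H.Adj x y ∧ pos x = pos y + 1
    · exact hx.imp fun y hy _ => hy
    · exact ⟨x, fun h => absurd h hx⟩
  choose low hlow using hex
  have key : ∀ x y, H.Adj x y → pos x = pos y + 1 → s(x, y) ∈
      (fun x => s(x, low x)) ''
        ((Finset.univ.filter fun x => ∃ y ∈ Finset.univ, H.Adj x y ∧ pos x = pos y + 1 :
          Finset V) : Set V) := by
    intro x y hxy hp
    refine ⟨x, by simpa using ⟨y, hxy, hp⟩, ?_⟩
    have h1 := hlow x ⟨y, hxy, hp⟩
    have : low x = y := h.2 x _ _ h1.1 hxy (by omega)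
    simp only [this]
  have hsub : H.edgeSet ⊆ (fun x => s(x, low x)) ''
      ((Finset.univ.filter fun x => ∃ y ∈ Finset.univ, H.Adj x y ∧ pos x = pos y + 1 :
        Finset V) : Set V) := by
    intro e
    induction e with
    | h x y =>
      intro hxy
      rcases h.1 x y hxy with hp | hp
      · exact key x y hxy hp
      · rw [Sym2.eq_swap]
        exact key y x (SimpleGraph.Adj.symm hxy) hp
  refine (Set.ncard_le_ncard hsub (Set.toFinite _)).trans ?_
  refine (Set.ncard_image_le (Set.toFinite _)).trans ?_
  rw [Set.ncard_coe_finset, lowerCount]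
  exact le_of_eq (by congr)

/-- A vertex of `S` with the least number is not counted. -/
lemma lowerCount_lt_card {S : Finset V} (hS : S.Nonempty) :
    lowerCount H pos S < S.card := by
  classical
  obtain ⟨m, hm, hmin⟩ := S.exists_min_image pos hS
  refine Finset.card_lt_card (Finset.filter_ssubset.2 ⟨m, hm, ?_⟩)
  rintro ⟨y, hy, -, hp⟩
  have := hmin y hy
  omega

lemma lowerCount_union_le_of_not_adj [DecidableEq V] {A B : Finset V}
    (hAB : ∀ x ∈ A, ∀ y ∈ B, ¬ H.Adj x y) :
    lowerCount H pos (A ∪ B) ≤ lowerCount H pos A + lowerCount H pos B := by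
  classical
  refine le_trans (Finset.card_le_card ?_) (Finset.card_union_le _ _)
  intro x
  simp only [Finset.mem_union, Finset.mem_filter]
  rintro ⟨hx | hx, y, hy | hy, hxy, hp⟩
  · exact .inl ⟨hx, y, hy, hxy, hp⟩
  · exact absurd hxy (hAB x hx y hy)
  · exact absurd hxy.symm (hAB y hy x hx)
  · exact .inr ⟨hx, y, hy, hxy, hp⟩

/-- A counted vertex lies in `A`, or its lower neighbour does, or both lie in `B`. The second kind
is at most `|A|` because each vertex of `A` is the lower neighbour of at most one vertex. -/
lemma lowerCount_union_le [DecidableEq V] (h : IsPosition H pos) {A B : Finset V} :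
    lowerCount H pos (A ∪ B) ≤ 2 * A.card + lowerCount H pos B := by
  classical
  have hC : ((A ∪ B).filter fun x => ∃ y ∈ A, H.Adj x y ∧ pos x = pos y + 1).card ≤ A.card := by
    have hex : ∀ x, ∃ y, (∃ y ∈ A, H.Adj x y ∧ pos x = pos y + 1) →
        y ∈ A ∧ H.Adj x y ∧ pos x = pos y + 1 := by
      intro x
      by_cases hx : ∃ y ∈ A, H.Adj x y ∧ pos x = pos y + 1
      · exact hx.imp fun y hy _ => hy
      · exact ⟨x, fun h => absurd h hx⟩
    choose low hlow using hex
    refine Finset.card_le_card_of_injOn low ?_ ?_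
    · intro x hx
      exact (hlow x (Finset.mem_filter.1 hx).2).1
    · intro x hx x' hx' heq
      obtain ⟨-, h1, h2⟩ := hlow x (Finset.mem_filter.1 hx).2
      obtain ⟨-, h3, h4⟩ := hlow x' (Finset.mem_filter.1 hx').2
      rw [← heq] at h3 h4
      exact h.2 _ _ _ h1.symm h3.symm (by omega)
  have hsub : ((A ∪ B).filter fun x => ∃ y ∈ A ∪ B, H.Adj x y ∧ pos x = pos y + 1) ⊆
      A ∪ ((A ∪ B).filter fun x => ∃ y ∈ A, H.Adj x y ∧ pos x = pos y + 1) ∪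
        (B.filter fun x => ∃ y ∈ B, H.Adj x y ∧ pos x = pos y + 1) := by
    intro x
    simp only [Finset.mem_union, Finset.mem_filter]
    rintro ⟨hx | hx, y, hy | hy, hxy⟩
    · exact .inl (.inl hx)
    · exact .inl (.inl hx)
    · exact .inl (.inr ⟨.inr hx, y, hy, hxy⟩)
    · exact .inr ⟨hx, y, hy, hxy⟩
  have h1 := Finset.card_le_card hsub
  have h2 := Finset.card_union_le (A ∪ ((A ∪ B).filter fun x =>
    ∃ y ∈ A, H.Adj x y ∧ pos x = pos y + 1)) (B.filter fun x => ∃ y ∈ B, H.Adj x y ∧ pos x = pos y + 1)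
  have h3 := Finset.card_union_le A ((A ∪ B).filter fun x =>
    ∃ y ∈ A, H.Adj x y ∧ pos x = pos y + 1)
  have h4 : lowerCount H pos (A ∪ B) = ((A ∪ B).filter fun x =>
    ∃ y ∈ A ∪ B, H.Adj x y ∧ pos x = pos y + 1).card := by rw [lowerCount]
  have h5 : lowerCount H pos B =
    (B.filter fun x => ∃ y ∈ B, H.Adj x y ∧ pos x = pos y + 1).card := by rw [lowerCount]
  omega

end Positions
-- Correctness of bridging and insertion
section LinSpec

variable {V : Type u} {G : SimpleGraph V}

/-- A nonempty path of `G` whose ends belong to `R`. -/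
def IsPathWithEndsIn (G : SimpleGraph V) (R : V → Prop) (p : List V) : Prop :=
  p ≠ [] ∧ p.IsChain G.Adj ∧ (∀ x ∈ p.head?, R x) ∧ ∀ x ∈ p.getLast?, R x

lemma bridge_nil (Q : List (List V)) : bridge [] Q = Q := by simp [bridge]

lemma bridge_cons (a : V) (A p q : List V) (Q : List (List V)) :
    bridge (a :: A) (p :: q :: Q) = bridge A ((p ++ a :: q) :: Q) := by simp [bridge]

lemma length_bridge (A : List V) (Q : List (List V)) (h : A.length < Q.length) :
    (bridge A Q).length = Q.length - A.length := by
  induction A generalizing Q with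
  | nil => simp [bridge_nil]
  | cons a A ih =>
    match Q, h with
    | p :: q :: Q, h =>
      simp only [List.length_cons] at h
      rw [bridge_cons, ih _ (by simp only [List.length_cons]; omega)]
      simp only [List.length_cons]
      omega

/-- Bridge vertices are adjacent to all of `R`. The invariant is that the ends of the growing path
stay in `R`, although bridges now lie inside it, so the next bridge can be attached. -/
lemma exists_bridge_eq {R : V → Prop} (A p : List V) (Q : List (List V))
    (hl : A.length ≤ Q.length) (hA : ∀ a ∈ A, ∀ x, R x → G.Adj a x)
    (hp : IsPathWithEndsIn G R p) (hQ : ∀ q ∈ Q, IsPathWithEndsIn G R q) :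
    ∃ p', bridge A (p :: Q) = p' :: Q.drop A.length ∧ IsPathWithEndsIn G R p' ∧
      p'.Perm (A ++ (p ++ (Q.take A.length).flatten)) := by
  induction A generalizing p Q with
  | nil => exact ⟨p, by simp [bridge_nil], hp, by simp⟩
  | cons a A ih =>
    match Q, hl with
    | q :: Q, hl =>
      have hq := hQ q (by simp)
      have ha := hA a (by simp)
      obtain ⟨p', h1, h2, h3⟩ := ih (p ++ a :: q) Q (by simpa using hl)
        (fun b hb => hA b (by simp [hb])) (by
          obtain ⟨b, l, rfl⟩ := List.exists_cons_of_ne_nil hq.1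
          obtain ⟨c, l', rfl⟩ := List.exists_cons_of_ne_nil hp.1
          refine ⟨by simp, ?_, ?_, ?_⟩
          · refine List.isChain_append.2 ⟨hp.2.1, ?_, ?_⟩
            · refine List.isChain_cons_cons.2 ⟨ha _ (hq.2.2.1 b (by simp)), hq.2.1⟩
            · intro x hx y hy
              simp only [List.head?_cons, Option.mem_some_iff] at hy
              rw [← hy]
              exact (ha _ (hp.2.2.2 x hx)).symm
          · intro x hx
            exact hp.2.2.1 x (by simpa using hx)
          · intro x hx
            refine hq.2.2.2 x ?_
            rwa [List.getLast?_append_of_ne_nil _ (by simp), List.getLast?_cons_cons] at hx)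
        (fun r hr => hQ r (by simp [hr]))
      refine ⟨p', by rw [bridge_cons, h1]; simp, h2, h3.trans ?_⟩
      simp only [List.length_cons, List.take_succ_cons, List.flatten_cons, List.cons_append]
      classical
      refine List.perm_iff_count.2 fun x => ?_
      simp only [List.count_append, List.count_cons]
      omega

lemma insertInPath_spec (B p : List V) (hp : p ≠ []) (hc : p.IsChain G.Adj)
    (hB : ∀ b ∈ B, ∀ x ∈ p, G.Adj b x) :
    (insertInPath B p).1.IsChain G.Adj ∧ (insertInPath B p).1.head? = p.head? ∧
      (insertInPath B p).1.getLast? = p.getLast? ∧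
      ((insertInPath B p).1 ++ (insertInPath B p).2).Perm (p ++ B) ∧
      (insertInPath B p).2.length = B.length - (p.length - 1) ∧ (insertInPath B p).2 ⊆ B := by
  induction B generalizing p with
  | nil => simp [insertInPath, hc]
  | cons b B ih =>
    match p, hp with
    | [x], _ => simp [insertInPath]
    | x :: y :: p, _ =>
      have hxy := List.isChain_cons_cons.1 hc
      obtain ⟨h1, h2, h3, h4, h5, h6⟩ := ih (y :: p) (by simp) hxy.2
        fun c hc z hz => hB c (by simp [hc]) z (List.mem_cons_of_mem _ hz)
      simp only [insertInPath]
      set r := insertInPath B (y :: p)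
      obtain ⟨z, l, hr⟩ : ∃ z l, r.1 = z :: l := by
        refine List.exists_cons_of_ne_nil ?_
        intro h
        rw [h] at h2
        simp at h2
      rw [hr] at h1 h2 h3 h4 ⊢
      have hzy : z = y := by simpa using h2
      subst hzy
      refine ⟨?_, by simp, ?_, ?_, ?_, List.subset_cons_of_subset b h6⟩
      · refine List.isChain_cons_cons.2 ⟨(hB b (by simp) x (by simp)).symm, ?_⟩
        exact List.isChain_cons_cons.2 ⟨hB b (by simp) z (by simp), h1⟩
      · rw [List.getLast?_cons_cons, List.getLast?_cons_cons, h3, List.getLast?_cons_cons]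
      · classical
        rw [List.perm_iff_count] at h4 ⊢
        intro a
        have := h4 a
        simp only [List.count_append, List.count_cons, List.cons_append] at this ⊢
        omega
      · rw [h5]
        simp only [List.length_cons]
        omega

/-- Insertion never changes the ends, so the paths can still be bridged afterwards. The number of
available gaps is `Q.flatten.length - Q.length`. -/
lemma insertInPaths_spec {R : V → Prop} (B : List V) (Q : List (List V))
    (hQ : ∀ q ∈ Q, q ≠ [] ∧ q.IsChain G.Adj ∧ ∀ x ∈ q, R x)
    (hB : ∀ b ∈ B, ∀ x, R x → G.Adj b x) :
    (∀ q ∈ (insertInPaths B Q).1, IsPathWithEndsIn G R q) ∧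
      ((insertInPaths B Q).1.flatten ++ (insertInPaths B Q).2).Perm (B ++ Q.flatten) ∧
      (insertInPaths B Q).1.length = Q.length ∧
      (insertInPaths B Q).2.length ≤ B.length - (Q.flatten.length - Q.length) ∧
      Q.length ≤ Q.flatten.length ∧ (insertInPaths B Q).2 ⊆ B := by
  induction Q generalizing B with
  | nil => simp [insertInPaths]
  | cons p Q ih =>
    obtain ⟨hp, hc, hR⟩ := hQ p (by simp)
    obtain ⟨h1, h2, h3, h4, h5, h6⟩ := insertInPath_spec B p hp hc fun b hb x hx => hB b hb x (hR x hx)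
    simp only [insertInPaths]
    have hsub : ∀ b ∈ (insertInPath B p).2, ∀ x, R x → G.Adj b x :=
      fun b hb => hB b (h6 hb)
    obtain ⟨i1, i2, i3, i4, i5, i6⟩ := ih (insertInPath B p).2 (fun q hq => hQ q (by simp [hq])) hsub
    have hpos := List.length_pos_iff.2 hp
    refine ⟨?_, ?_, by simp [i3], ?_, ?_, fun _ h => h6 (i6 h)⟩
    · intro q hq
      rcases List.mem_cons.1 hq with rfl | hq
      · refine ⟨?_, h1, ?_, ?_⟩
        · intro h
          rw [h] at h2
          cases p <;> simp at h2 hp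
        · rw [h2]; exact fun x hx => hR x (List.mem_of_head? hx)
        · rw [h3]; exact fun x hx => hR x (List.mem_of_getLast? hx)
      · exact i1 q hq
    · classical
      rw [List.perm_iff_count] at h4 i2 ⊢
      intro a
      have e1 := h4 a
      have e2 := i2 a
      simp only [List.count_append, List.flatten_cons] at e1 e2 ⊢
      omega
    · simp only [List.flatten_cons, List.length_append, List.length_cons]
      omega
    · simp only [List.flatten_cons, List.length_append, List.length_cons]
      omega

end LinSpec
-- The computed cover: validity, optimality and shape
section LinCover

variable {V : Type u} {G : SimpleGraph V}

lemma length_joinCover (A : List V) (Q : List (List V)) :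
    (joinCover A Q).length = max 1 (Q.length - A.length) := by
  unfold joinCover
  split_ifs with h
  · rw [length_bridge A Q h]
    omega
  · simp only [List.length_singleton]
    omega

lemma joinCover_spec (A : List V) (Q : List (List V)) (hQ₀ : Q ≠ [])
    (hQ : ∀ q ∈ Q, q ≠ [] ∧ q.IsChain G.Adj) (hA : ∀ a ∈ A, ∀ x ∈ Q.flatten, G.Adj a x)
    (hl : A.length ≤ Q.flatten.length) :
    (∀ q ∈ joinCover A Q, q ≠ [] ∧ q.IsChain G.Adj) ∧
      (joinCover A Q).flatten.Perm (A ++ Q.flatten) := by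
  have hQR : ∀ q ∈ Q, ∀ x ∈ q, x ∈ Q.flatten := fun q hq x hx =>
    List.mem_flatten.2 ⟨q, hq, hx⟩
  unfold joinCover
  split_ifs with h
  · obtain ⟨p, Q, rfl⟩ := List.exists_cons_of_ne_nil hQ₀
    have hends : ∀ q ∈ p :: Q, IsPathWithEndsIn G (· ∈ (p :: Q).flatten) q := fun q hq =>
      ⟨(hQ q hq).1, (hQ q hq).2, fun x hx => hQR q hq x (List.mem_of_head? hx),
        fun x hx => hQR q hq x (List.mem_of_getLast? hx)⟩
    obtain ⟨p', h1, h2, h3⟩ := exists_bridge_eq A p Q (by simpa [Nat.lt_succ_iff] using h) hA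
      (hends p (by simp)) fun q hq => hends q (by simp [hq])
    rw [h1]
    refine ⟨fun q hq => ?_, ?_⟩
    · rcases List.mem_cons.1 hq with rfl | hq
      · exact ⟨h2.1, h2.2.1⟩
      · exact hQ q (by simp [List.mem_of_mem_drop hq])
    · rw [List.flatten_cons, List.flatten_cons]
      refine (h3.append_right _).trans ?_
      rw [List.append_assoc, List.append_assoc, ← List.flatten_append, List.take_append_drop]
  · obtain ⟨i1, i2, i3, i4, i5, i6⟩ := insertInPaths_spec (G := G) (R := (· ∈ Q.flatten))
      (A.drop (Q.length - 1)) Q (fun q hq => ⟨(hQ q hq).1, (hQ q hq).2, hQR q hq⟩)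
      fun b hb => hA b (List.mem_of_mem_drop hb)
    set s := insertInPaths (A.drop (Q.length - 1)) Q
    have hlen := List.length_pos_iff.2 hQ₀
    obtain ⟨p, Q', hs⟩ := List.exists_cons_of_length_pos (i3 ▸ hlen : 0 < s.1.length)
    rw [hs] at i1 i2 i3
    simp only [List.length_cons] at i3
    have htake : (A.take (Q.length - 1)).length = Q'.length := by
      rw [List.length_take]; omega
    obtain ⟨p', h1, h2, h3⟩ := exists_bridge_eq (G := G) (R := (· ∈ Q.flatten))
      (A.take (Q.length - 1)) p Q' htake.le
      (fun a ha => hA a (List.mem_of_mem_take ha)) (i1 p (by simp)) fun q hq => i1 q (by simp [hq])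
    rw [htake, List.drop_length] at h1
    rw [htake, List.take_length] at h3
    have hperm : (p' ++ s.2).Perm (A ++ Q.flatten) := by
      refine (h3.append_right _).trans ?_
      rw [List.append_assoc]
      refine (i2.append_left _).trans ?_
      rw [← List.append_assoc, List.take_append_drop]
    dsimp only
    rw [hs, h1]
    simp only [List.flatten_cons, List.flatten_nil, List.append_nil]
    refine ⟨fun q hq => ?_, hperm⟩
    rw [List.mem_singleton] at hq
    subst hq
    refine ⟨by simp [h2.1], List.isChain_append.2 ⟨h2.2.1, ?_, ?_⟩⟩
    -- With `|Q| - 1` bridges and one inserted vertex per gap, room for all but one of as many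
    -- vertices as `Q` covers is available; this is where the smaller side being on the left
    -- matters.
    · have : s.2.length ≤ 1 := by
        rw [List.length_drop] at i4
        omega
      match s.2, this with
      | [], _ => simp
      | [_], _ => simp
    · intro x hx y hy
      have hy' : y ∈ A := List.mem_of_mem_drop (i6 (List.mem_of_head? hy))
      exact (hA y hy' x (h2.2.2.2 x hx)).symm

/-- Leaves in the two subtrees of a node are adjacent in `G` iff the node is labelled `1`. -/
def IsCompatible (G : SimpleGraph V) : BinaryCotree V → Prop
  | .leaf _ => True
  | .node b l r => IsCompatible G l ∧ IsCompatible G r ∧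
      ∀ x ∈ l.leaves, ∀ y ∈ r.leaves, (G.Adj x y ↔ b = true)

/-- At every node, the left subtree has at most as many leaves as the right one. -/
def IsArranged : BinaryCotree V → Prop
  | .leaf _ => True
  | .node _ l r => IsArranged l ∧ IsArranged r ∧ l.leaves.length ≤ r.leaves.length

lemma leaves_ne_nil : ∀ T : BinaryCotree V, T.leaves ≠ []
  | .leaf _ => by simp [BinaryCotree.leaves]
  | .node _ l _ => by simp [BinaryCotree.leaves, leaves_ne_nil l]

lemma leaves_arrange_perm : ∀ T : BinaryCotree V, T.arrange.leaves.Perm T.leaves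
  | .leaf _ => .rfl
  | .node b l r => by
      simp only [BinaryCotree.arrange]
      split_ifs with h
      · exact (leaves_arrange_perm l).append (leaves_arrange_perm r)
      · exact ((leaves_arrange_perm r).append (leaves_arrange_perm l)).trans List.perm_append_comm

lemma isArranged_arrange : ∀ T : BinaryCotree V, IsArranged T.arrange
  | .leaf _ => trivial
  | .node b l r => by
      have h1 := (leaves_arrange_perm l).length_eq
      have h2 := (leaves_arrange_perm r).length_eq
      simp only [BinaryCotree.arrange]
      split_ifs with h
      · exact ⟨isArranged_arrange l, isArranged_arrange r, by omega⟩
      · exact ⟨isArranged_arrange r, isArranged_arrange l, by omega⟩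

lemma IsCompatible.arrange : ∀ {T : BinaryCotree V}, IsCompatible G T → IsCompatible G T.arrange
  | .leaf _, _ => trivial
  | .node b l r, ⟨h1, h2, h3⟩ => by
      simp only [BinaryCotree.arrange]
      split_ifs with h
      · refine ⟨h1.arrange, h2.arrange, fun x hx y hy => ?_⟩
        exact h3 x ((leaves_arrange_perm l).mem_iff.1 hx) y ((leaves_arrange_perm r).mem_iff.1 hy)
      · refine ⟨h2.arrange, h1.arrange, fun x hx y hy => ?_⟩
        rw [G.adj_comm]
        exact h3 y ((leaves_arrange_perm l).mem_iff.1 hy) x ((leaves_arrange_perm r).mem_iff.1 hx)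

lemma linPathCover_spec : ∀ {T : BinaryCotree V}, IsCompatible G T → IsArranged T →
    (∀ p ∈ linPathCover T, p ≠ [] ∧ p.IsChain G.Adj) ∧
      (linPathCover T).flatten.Perm T.leaves ∧ linPathCover T ≠ []
  | .leaf v, _, _ => by simp [linPathCover, BinaryCotree.leaves]
  | .node false l r, hc, ha => by
      obtain ⟨l1, l2, l3⟩ := linPathCover_spec hc.1 ha.1
      obtain ⟨r1, r2, r3⟩ := linPathCover_spec hc.2.1 ha.2.1
      refine ⟨fun p hp => ?_, ?_, by simp [linPathCover, l3]⟩
      · exact (List.mem_append.1 hp).elim (l1 p) (r1 p)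
      · rw [linPathCover, List.flatten_append]
        exact l2.append r2
  | .node true l r, hc, ha => by
      obtain ⟨r1, r2, r3⟩ := linPathCover_spec hc.2.1 ha.2.1
      obtain ⟨h1, h2⟩ := joinCover_spec l.leaves (linPathCover r) r3 r1
        (fun a ha x hx => (hc.2.2 a ha x (r2.mem_iff.1 hx)).2 rfl) (r2.length_eq ▸ ha.2.2)
      refine ⟨h1, h2.trans (r2.append_left _), ?_⟩
      rw [← List.length_pos_iff, linPathCover, length_joinCover]
      omega

/-- This is the optimality certificate. At a `0`-node both quantities split over the two sides,
since no edge crosses. At a `1`-node the number of paths is a maximum: its value `1` is matched by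
`lowerCount_lt_card`, its value `|Q| - |A|` by `lowerCount_union_le` and induction on the right side
only. -/
lemma lowerCount_add_length_le [DecidableEq V] {H : SimpleGraph V} {pos : V → ℕ}
    (hH : IsPosition H pos) (hle : H ≤ G) : ∀ {T : BinaryCotree V}, IsCompatible G T →
      lowerCount H pos T.leaves.toFinset + (linPathCover T).length ≤ T.leaves.length
  | .leaf v, _ => by
      have := lowerCount_lt_card (H := H) (pos := pos) (S := {v}) (by simp)
      simp only [BinaryCotree.leaves, linPathCover, List.length_singleton, List.toFinset_cons,
        List.toFinset_nil, insert_empty_eq, Finset.card_singleton] at *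
      omega
  | .node false l r, hc => by
      have h1 := lowerCount_add_length_le hH hle hc.1
      have h2 := lowerCount_add_length_le hH hle hc.2.1
      have h3 := lowerCount_union_le_of_not_adj (H := H) (pos := pos)
        (A := l.leaves.toFinset) (B := r.leaves.toFinset) fun x hx y hy hxy => by
          have := (hc.2.2 x (by simpa using hx) y (by simpa using hy)).1 (hle hxy)
          simp at this
      simp only [BinaryCotree.leaves, linPathCover, List.length_append, List.toFinset_append]
      omega
  | .node true l r, hc => by
      have h2 := lowerCount_add_length_le hH hle hc.2.1
      have h3 := lowerCount_union_le hH (A := l.leaves.toFinset) (B := r.leaves.toFinset)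
      have h4 := List.toFinset_card_le l.leaves
      have h5 := lowerCount_lt_card (H := H) (pos := pos)
        (S := l.leaves.toFinset ∪ r.leaves.toFinset)
        (.inl ((List.toFinset_nonempty_iff _).2 (leaves_ne_nil l)))
      have h6 := Finset.card_union_le l.leaves.toFinset r.leaves.toFinset
      have h7 := List.toFinset_card_le r.leaves
      simp only [BinaryCotree.leaves, linPathCover, List.length_append, List.toFinset_append,
        length_joinCover]
      omega

lemma isPathSystem_linPathCover {T : BinaryCotree V} (hc : IsCompatible G T) (ha : IsArranged T)
    (hn : T.leaves.Nodup) (hall : ∀ v, v ∈ T.leaves) : IsPathSystem G (linPathCover T) := by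
  obtain ⟨h1, h2, -⟩ := linPathCover_spec hc ha
  exact ⟨h1, h2.nodup_iff.2 hn, fun v => h2.mem_iff.2 (hall v)⟩

lemma isOptimalPathCover_linPathCover [Finite V] [Nonempty V] {T : BinaryCotree V}
    (hc : IsCompatible G T) (ha : IsArranged T)
    (hn : T.leaves.Nodup) (hall : ∀ v, v ∈ T.leaves) :
    IsOptimalPathCover G (pathsGraph (linPathCover T)) := by
  classical
  cases nonempty_fintype V
  have hP := isPathSystem_linPathCover hc ha hn hall
  refine ⟨isPathCover_pathsGraph hP, fun Q hQ => ?_⟩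
  obtain ⟨pos, hpos⟩ := hQ.exists_isPosition
  have h1 := edgeCount_le_lowerCount hpos
  have h2 := lowerCount_add_length_le hpos hQ.1 hc
  have h3 := edgeCount_pathsGraph_add_length hP
  have h4 := length_eq_card hn hall
  have h5 : T.leaves.toFinset = Finset.univ := by
    ext v; simp [hall]
  rw [h5] at h2
  omega

/-- If several paths remain, the step at the root only bridged: the first path has absorbed all left
leaves, and the others are untouched paths of the right side. -/
lemma isStartingCover_linPathCover [Finite V] [Nonempty V] {l r : BinaryCotree V}
    (hc : IsCompatible G (.node true l r)) (ha : IsArranged (.node true l r))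
    (hn : (BinaryCotree.node true l r).leaves.Nodup)
    (hall : ∀ v, v ∈ (BinaryCotree.node true l r).leaves) :
    IsStartingCover G (.node true l r) (linPathCover (.node true l r)) := by
  refine ⟨isPathSystem_linPathCover hc ha hn hall,
    isOptimalPathCover_linPathCover hc ha hn hall, ?_⟩
  obtain ⟨r1, r2, r3⟩ := linPathCover_spec hc.2.1 ha.2.1
  rw [linPathCover, length_joinCover]
  by_cases hlt : l.leaves.length < (linPathCover r).length
  swap
  · left; omega
  by_cases hone : (linPathCover r).length - l.leaves.length = 1
  · left; omega
  right
  refine ⟨by omega, ?_⟩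
  rw [joinCover, if_pos hlt]
  obtain ⟨p, Q, hpQ⟩ := List.exists_cons_of_ne_nil r3
  rw [hpQ] at r1 r2 hlt ⊢
  have hmem : ∀ q ∈ p :: Q, ∀ x ∈ q, x ∈ r.leaves := fun q hq x hx =>
    r2.mem_iff.1 (List.mem_flatten.2 ⟨q, hq, hx⟩)
  have hends : ∀ q ∈ p :: Q, IsPathWithEndsIn G (· ∈ r.leaves) q := fun q hq =>
    ⟨(r1 q hq).1, (r1 q hq).2, fun x hx => hmem q hq x (List.mem_of_head? hx),
      fun x hx => hmem q hq x (List.mem_of_getLast? hx)⟩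
  obtain ⟨p', h1, -, h3⟩ := exists_bridge_eq l.leaves p Q (by simpa [Nat.lt_succ_iff] using hlt)
    (fun a ha x hx => (hc.2.2 a ha x hx).2 rfl)
    (hends p (by simp)) fun q hq => hends q (by simp [hq])
  obtain ⟨a, ha'⟩ := List.exists_mem_of_ne_nil _ (leaves_ne_nil l)
  obtain ⟨b, hb⟩ := List.exists_mem_of_ne_nil _ (r1 p (by simp)).1
  rw [h1]
  refine ⟨p', by simp, ⟨a, h3.mem_iff.2 (by simp [ha']), ha'⟩,
    ⟨b, h3.mem_iff.2 (by simp [hb]), hmem p (by simp) b hb⟩, fun q hq hne x hx => ?_⟩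
  exact hmem q (List.mem_cons_of_mem _ (List.mem_of_mem_drop
    ((List.mem_cons.1 hq).resolve_left hne))) x hx

end LinCover
-- Cotrees: recursive description, existence, and the root label
section Cotrees

variable {V : Type u} {G : SimpleGraph V}

lemma lcaIsOne_iff_of_isCompatible : ∀ {T : BinaryCotree V}, IsCompatible G T → T.leaves.Nodup →
    ∀ x ∈ T.leaves, ∀ y ∈ T.leaves, x ≠ y → (G.Adj x y ↔ T.LcaIsOne x y)
  | .leaf v, _, _, x, hx, y, hy, hxy => by
      simp only [BinaryCotree.leaves, List.mem_singleton] at hx hy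
      exact absurd (hx.trans hy.symm) hxy
  | .node b l r, hc, hn, x, hx, y, hy, hxy => by
      simp only [BinaryCotree.leaves] at hn hx hy
      obtain ⟨hl, hr, hd⟩ := List.nodup_append'.1 hn
      have il := lcaIsOne_iff_of_isCompatible hc.1 hl x
      have ir := lcaIsOne_iff_of_isCompatible hc.2.1 hr x
      have hx' : x ∈ l.leaves → x ∉ r.leaves := fun h h' => hd h h'
      have hy' : y ∈ l.leaves → y ∉ r.leaves := fun h h' => hd h h'
      simp only [BinaryCotree.LcaIsOne]
      rcases List.mem_append.1 hx with hx | hx <;> rcases List.mem_append.1 hy with hy | hy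
      · have := il hx y hy hxy
        tauto
      · have := hc.2.2 x hx y hy
        tauto
      · have := hc.2.2 y hy x hx
        rw [G.adj_comm] at this
        tauto
      · have := ir hx y hy hxy
        tauto

lemma isCompatible_of_lcaIsOne_iff : ∀ {T : BinaryCotree V}, T.leaves.Nodup →
    (∀ x ∈ T.leaves, ∀ y ∈ T.leaves, x ≠ y → (G.Adj x y ↔ T.LcaIsOne x y)) → IsCompatible G T
  | .leaf _, _, _ => trivial
  | .node b l r, hn, h => by
      simp only [BinaryCotree.leaves] at hn h
      obtain ⟨hl, hr, hd⟩ := List.nodup_append'.1 hn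
      have hd' : ∀ x, x ∈ l.leaves → x ∉ r.leaves := fun x h h' => hd h h'
      refine ⟨isCompatible_of_lcaIsOne_iff hl fun x hx y hy hxy => ?_,
        isCompatible_of_lcaIsOne_iff hr fun x hx y hy hxy => ?_, fun x hx y hy => ?_⟩
      · rw [h x (List.mem_append_left _ hx) y (List.mem_append_left _ hy) hxy]
        have h1 := hd' x hx
        have h2 := hd' y hy
        simp only [BinaryCotree.LcaIsOne]
        tauto
      · rw [h x (List.mem_append_right _ hx) y (List.mem_append_right _ hy) hxy]
        have h1 := hd' x
        have h2 := hd' y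
        simp only [BinaryCotree.LcaIsOne]
        tauto
      · have hxy : x ≠ y := by
          rintro rfl
          exact hd hx hy
        rw [h x (List.mem_append_left _ hx) y (List.mem_append_right _ hy) hxy]
        have h1 := hd' x hx
        have h2 := hd' y
        simp only [BinaryCotree.LcaIsOne]
        tauto

/-- Turns the condition on lowest common ancestors into a node-by-node one, which suits induction
and is stable under exchanging subtrees. -/
lemma isCotreeOf_iff {T : BinaryCotree V} :
    T.IsCotreeOf G ↔ T.leaves.Nodup ∧ (∀ v, v ∈ T.leaves) ∧ IsCompatible G T := by
  constructor
  · rintro ⟨hn, hall, h⟩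
    exact ⟨hn, hall, isCompatible_of_lcaIsOne_iff hn fun x _ y _ hxy => h x y hxy⟩
  · rintro ⟨hn, hall, h⟩
    exact ⟨hn, hall, fun x y hxy =>
      lcaIsOne_iff_of_isCompatible h hn x (hall x) y (hall y) hxy⟩

namespace BinaryCotree

/-- Rename the leaves. -/
def map {W : Type u} (f : V → W) : BinaryCotree V → BinaryCotree W
  | leaf v => leaf (f v)
  | node b l r => node b (l.map f) (r.map f)

/-- Exchange the labels `0` and `1`. -/
def flip : BinaryCotree V → BinaryCotree V
  | leaf v => leaf v
  | node b l r => node (!b) l.flip r.flip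

lemma leaves_map {W : Type u} (f : V → W) : ∀ T : BinaryCotree V, (T.map f).leaves = T.leaves.map f
  | leaf _ => rfl
  | node _ l r => by simp [map, leaves, leaves_map f l, leaves_map f r]

lemma leaves_flip : ∀ T : BinaryCotree V, T.flip.leaves = T.leaves
  | leaf _ => rfl
  | node _ l r => by simp [flip, leaves, leaves_flip l, leaves_flip r]

end BinaryCotree

lemma IsCompatible.map {W : Type u} {H : SimpleGraph W} {f : V → W}
    (hf : ∀ x y, H.Adj (f x) (f y) ↔ G.Adj x y) :
    ∀ {T : BinaryCotree V}, IsCompatible G T → IsCompatible H (T.map f)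
  | .leaf _, _ => trivial
  | .node b l r, hc => by
      refine ⟨hc.1.map hf, hc.2.1.map hf, ?_⟩
      simp only [BinaryCotree.leaves_map, List.mem_map]
      rintro _ ⟨x, hx, rfl⟩ _ ⟨y, hy, rfl⟩
      rw [hf]
      exact hc.2.2 x hx y hy

/-- Distinctness of the leaves is needed because a vertex on both sides would be nonadjacent to
itself in the complement too. -/
lemma IsCompatible.flip : ∀ {T : BinaryCotree V}, T.leaves.Nodup → IsCompatible G T →
    IsCompatible Gᶜ T.flip
  | .leaf _, _, _ => trivial
  | .node b l r, hn, hc => by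
      obtain ⟨hl, hr, hd⟩ := List.nodup_append'.1 hn
      refine ⟨hc.1.flip hl, hc.2.1.flip hr, ?_⟩
      simp only [BinaryCotree.leaves_flip]
      intro x hx y hy
      have hxy : x ≠ y := by
        rintro rfl
        exact hd hx hy
      have := hc.2.2 x hx y hy
      rw [SimpleGraph.compl_adj, this]
      cases b <;> simp [hxy]

/-- Complements exchange the labels, disjoint unions put a `0`-node on top, and isomorphisms rename
the leaves. -/
lemma IsCograph.exists_isCotreeOf (h : IsCograph G) : ∃ T : BinaryCotree V, T.IsCotreeOf G := by
  simp only [isCotreeOf_iff]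
  induction h with
  | @single V h₁ _ G =>
    obtain ⟨v⟩ := h₁
    exact ⟨.leaf v, by simp [BinaryCotree.leaves], fun w => by
      simp [BinaryCotree.leaves, Subsingleton.elim w v], trivial⟩
  | compl _ ih =>
    obtain ⟨T, hn, hall, hc⟩ := ih
    exact ⟨T.flip, by rwa [T.leaves_flip], by rwa [T.leaves_flip], hc.flip hn⟩
  | disjUnion _ _ ih₁ ih₂ =>
    obtain ⟨T₁, hn₁, hall₁, hc₁⟩ := ih₁
    obtain ⟨T₂, hn₂, hall₂, hc₂⟩ := ih₂
    refine ⟨.node false (T₁.map Sum.inl) (T₂.map Sum.inr), ?_, ?_,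
      hc₁.map (by simp), hc₂.map (by simp), ?_⟩
    · simp only [BinaryCotree.leaves, BinaryCotree.leaves_map]
      refine List.nodup_append'.2 ⟨hn₁.map Sum.inl_injective, hn₂.map Sum.inr_injective, ?_⟩
      intro x hx hy
      obtain ⟨a, -, rfl⟩ := List.mem_map.1 hx
      simp at hy
    · simp only [BinaryCotree.leaves, BinaryCotree.leaves_map]
      rintro (v | v) <;> simp [hall₁, hall₂]
    · simp only [BinaryCotree.leaves_map, List.mem_map]
      rintro _ ⟨x, -, rfl⟩ _ ⟨y, -, rfl⟩
      simp
  | iso e _ ih =>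
    obtain ⟨T, hn, hall, hc⟩ := ih
    refine ⟨T.map e, ?_, fun w => ?_, hc.map fun x y => e.map_adj_iff⟩
    · rw [T.leaves_map]
      exact hn.map e.injective
    · rw [T.leaves_map]
      exact List.mem_map.2 ⟨e.symm w, hall _, by simp⟩

/-- The root of a cotree of a connected graph is a `1`-node. -/
lemma IsCompatible.exists_eq_node [Nontrivial V] (hconn : G.Connected) {T : BinaryCotree V}
    (hc : IsCompatible G T) (hn : T.leaves.Nodup) (hall : ∀ v, v ∈ T.leaves) :
    ∃ l r, T = .node true l r := by
  match T with
  | .leaf v =>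
    obtain ⟨w, hw⟩ := exists_ne v
    exact absurd (hall w) (by simpa [BinaryCotree.leaves] using hw)
  | .node true l r => exact ⟨l, r, rfl⟩
  | .node false l r =>
    exfalso
    obtain ⟨x, hx⟩ := List.exists_mem_of_ne_nil _ (leaves_ne_nil l)
    obtain ⟨y, hy⟩ := List.exists_mem_of_ne_nil _ (leaves_ne_nil r)
    have hd := (List.nodup_append'.1 hn).2.2
    -- Below a `0`-root, a walk that starts among the left leaves can never leave them.
    obtain ⟨w⟩ := hconn.preconnected x y
    induction w with
    | nil => exact hd hx hy
    | @cons a b _ hab _ ih =>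
      refine ih ?_ hy
      rcases List.mem_append.1 (hall b) with hb | hb
      · exact hb
      · simpa using (hc.2.2 a hx b hb).1 hab

end Cotrees

/-! ### The spanning tree algorithm -/

section Algorithm

variable {V : Type u} {G : SimpleGraph V} {l r : BinaryCotree V} {Q : List (List V)}

/-- Makes the single-path output the star construction without added edges, so that `starGraph_spec`
covers both cases. -/
lemma starGraph_of_length_eq_one {p₁ : List V} (hQ : Q = [p₁]) (u : V) (e : List V → V) :
    starGraph Q p₁ u e = pathsGraph Q := by
  refine sup_eq_left.2 ?_
  intro x y hxy
  rw [SimpleGraph.fromEdgeSet_adj] at hxy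
  obtain ⟨⟨p, hp, hne, -⟩, -⟩ := hxy
  rw [hQ, List.mem_singleton] at hp
  exact absurd hp hne

lemma exists_isOutput
    (hQ : IsStartingCover G (.node true l r) Q) : ∃ S, IsOutput (.node true l r) Q S := by
  obtain ⟨hP, -, h1 | ⟨h2, p₁, hp₁, ⟨u, hu, hul⟩, hy, -⟩⟩ := hQ
  · exact ⟨_, .inl ⟨h1, rfl⟩⟩
  · refine ⟨_, .inr ⟨by omega, p₁, hp₁, ⟨u, hu, hul⟩, hy, u, hu, hul,
      fun p => p.head?.getD u, fun p hp _ => .inl ?_, rfl⟩⟩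
    obtain ⟨a, t, rfl⟩ := List.exists_cons_of_ne_nil (hP.1 p hp).1
    simp

lemma IsOutput.spec [Finite V] [Nontrivial V] (hc : IsCompatible G (.node true l r))
    (hn : (BinaryCotree.node true l r).leaves.Nodup)
    (hQ : IsStartingCover G (.node true l r) Q) {S : SimpleGraph V}
    (hS : IsOutput (.node true l r) Q S) :
    IsSpanningTree G S ∧ ∀ P, IsOptimalPathCover G P → internalCount S + 1 = edgeCount P := by
  obtain ⟨hP, hopt, hform⟩ := hQ
  rcases hS with ⟨h1, rfl⟩ | ⟨h1, p₁, hp₁, -, -, u, hu, hul, e, he, rfl⟩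
  · obtain ⟨p₁, rfl⟩ := List.length_eq_one_iff.1 h1
    obtain ⟨u, hu⟩ := List.exists_mem_of_ne_nil _ (hP.1 p₁ (by simp)).1
    have h := starGraph_spec hP hopt (List.mem_singleton_self p₁) hu (e := fun _ => u)
      (fun p hp hne => absurd (List.mem_singleton.1 hp) hne)
      (fun p hp hne => absurd (List.mem_singleton.1 hp) hne)
    rwa [starGraph_of_length_eq_one rfl] at h
  · refine starGraph_spec hP hopt hp₁ hu he fun p hp hne => ?_
    obtain ⟨-, p₂, hp₂, -, -, hR⟩ := hform.resolve_left h1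
    -- The path chosen by the algorithm is the distinguished one of the starting cover, because it
    -- contains the left leaf `u`.
    have h12 : p₁ = p₂ := by
      by_contra h
      exact (List.nodup_append'.1 hn).2.2 hul (hR p₁ hp₁ h u hu)
    subst h12
    exact (hc.2.2 u hul _ (hR p hp hne _ (he p hp hne).mem)).2 rfl

end Algorithm
end CographMIST

theorem mainTheorem3 {V : Type*} [Finite V] [Nontrivial V] (G : SimpleGraph V)
    (hG : CographMIST.IsCograph G) (hconn : G.Connected) :
    -- every such graph has an input for the algorithm
    (∃ T : CographMIST.BinaryCotree V, T.IsCotreeOf G) ∧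
    -- on every input, step one computes an optimal path cover of the form which is used in the
    -- later steps, and the algorithm returns spanning trees with `|E(P*)| - 1` internal vertices
    (∀ T : CographMIST.BinaryCotree V, T.IsCotreeOf G →
      CographMIST.IsStartingCover G T.arrange (CographMIST.linPathCover T.arrange) ∧
      (∃ S, CographMIST.IsAlgorithmOutput T S) ∧
      ∀ S, CographMIST.IsAlgorithmOutput T S →
        CographMIST.IsSpanningTree G S ∧
        ∀ P, CographMIST.IsOptimalPathCover G P →
          CographMIST.internalCount S + 1 = CographMIST.edgeCount P) ∧
    -- the same holds if step one is replaced by another way to find such a path cover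
    (∀ T : CographMIST.BinaryCotree V, T.IsCotreeOf G →
      ∀ Q, CographMIST.IsStartingCover G T.arrange Q →
      (∃ S, CographMIST.IsOutput T.arrange Q S) ∧
      ∀ S, CographMIST.IsOutput T.arrange Q S →
        CographMIST.IsSpanningTree G S ∧
        ∀ P, CographMIST.IsOptimalPathCover G P →
          CographMIST.internalCount S + 1 = CographMIST.edgeCount P) ∧
    -- the largest number of internal vertices of a spanning tree is `|E(P*)| - 1`
    (∀ P, CographMIST.IsOptimalPathCover G P →
      CographMIST.opt G + 1 = CographMIST.edgeCount P) := by
  -- The claim for arbitrary starting covers includes the algorithm itself, once the computed cover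
  -- is known to be one.
  have key : ∀ T : CographMIST.BinaryCotree V, T.IsCotreeOf G →
      CographMIST.IsStartingCover G T.arrange (CographMIST.linPathCover T.arrange) ∧
      ∀ Q, CographMIST.IsStartingCover G T.arrange Q →
        (∃ S, CographMIST.IsOutput T.arrange Q S) ∧
        ∀ S, CographMIST.IsOutput T.arrange Q S → CographMIST.IsSpanningTree G S ∧
          ∀ P, CographMIST.IsOptimalPathCover G P →
            CographMIST.internalCount S + 1 = CographMIST.edgeCount P := by
    intro T hT
    obtain ⟨hn, hall, hc⟩ := CographMIST.isCotreeOf_iff.1 hT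
    have hperm := CographMIST.leaves_arrange_perm T
    replace hn := hperm.nodup_iff.2 hn
    replace hall := fun v => hperm.mem_iff.2 (hall v)
    replace hc := hc.arrange
    have ha := CographMIST.isArranged_arrange T
    obtain ⟨l, r, hlr⟩ := hc.exists_eq_node hconn hn hall
    rw [hlr] at hn hall hc ha ⊢
    exact ⟨CographMIST.isStartingCover_linPathCover hc ha hn hall, fun Q hQ =>
      ⟨CographMIST.exists_isOutput hQ, fun S hS => hS.spec hc hn hQ⟩⟩
  obtain ⟨T₀, hT₀⟩ := hG.exists_isCotreeOf
  refine ⟨⟨T₀, hT₀⟩, fun T hT => ⟨(key T hT).1, (key T hT).2 _ (key T hT).1⟩,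
    fun T hT => (key T hT).2, fun P hP => ?_⟩
  obtain ⟨⟨S, hS⟩, hout⟩ := (key T₀ hT₀).2 _ (key T₀ hT₀).1
  obtain ⟨hST, hcount⟩ := hout S hS
  exact CographMIST.opt_add_one_eq hST hP (hcount P hP)
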